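/- All graphs are finite, simple and undirected. A vertex (an edge) of a graph $G=(V,E)$ is a cut vertex (a cut edge) if deleting it increases the number of connected components. $G$ is vertex-biconnected (edge-biconnected) if it is connected and has no cut vertex (no cut edge). The vertex-biconnected (edge-biconnected) components of $G$ are the inclusion-maximal sets $S\subseteq V$ such that the induced subgraph $G[S]$ is vertex-biconnected (edge-biconnected). The block cut-vertex tree $\mathrm{BCVTree}(G)$ has as nodes the vertex-biconnected components and the cut vertices of $G$, and its edges are the pairs $\{S,v\}$ with $S$ a component, $v$ a cut vertex and $v\in S$. The block cut-edge tree $\mathrm{BCETree}(G)$ has as nodes the edge-biconnected components of $G$, two distinct components $S_1,S_2$ being adjacent if $\{u,v\}\in E$ for some $u\in S_1$, $v\in S_2$. 2-FWL. Let $\mathrm{hash}$ be an injective function, with values in a color set $\mathcal C$, that is defined on $2\times 2$ matrices over $\mathcal C$ and on pairs consisting of an element of $\mathcal C$ and a finite multiset of elements of $\mathcal C\times\mathcal C$. Fix three different colors $c_{\mathrm{node}},c_0,c_1\in\mathcal C$. For $u,v\in V$ let $a(u,v)$ be $c_{\mathrm{node}}$ if $u=v$, $c_1$ if $\{u,v\}\in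 E$, and $c_0$ otherwise. Put $$\chi_G^0(u,v)=\mathrm{hash}\begin{pmatrix}a(u,u)&a(u,v)\\a(v,u)&a(v,v)\end{pmatrix},\qquad \chi_G^{t}(u,v)=\mathrm{hash}\bigl(\chi_G^{t-1}(u,v),\{\!\{(\chi_G^{t-1}(w,v),\chi_G^{t-1}(u,w)):w\in V\}\!\}\bigr)\quad(t\ge 1),$$ where $\{\!\{\cdot\}\!\}$ denotes multisets. Let $G=(V_G,E_G)$ and $H=(V_H,E_H)$ be graphs, let $T\ge\max(|V_G|,|V_H|)^2$, and write $\chi_G(v)=\chi_G^T(v,v)$ and $\chi_H(v)=\chi_H^T(v,v)$ for the resulting vertex colors. Then: 1. If $G$ is vertex-biconnected and $H$ is not, or if $G$ is edge-biconnected and $H$ is not, then $\{\!\{\chi_G(v):v\in V_G\}\!\}\ne\{\!\{\chi_H(v):v\in V_H\}\!\}$. 2. If $u\in V_G$ is a cut vertex of $G$ and $v\in V_H$ is not a cut vertex of $H$, then $\chi_G(u)\ne\chi_H(v)$. 3. If $\{u,v\}\in E_G$ is a cut edge of $G$ and $\{w,x\}\in E_H$ is not a cut edge of $H$, then $\{\!\{\chi_G(u),\chi_G(v)\}\!\}\ne\{\!\{\chi_H(w),\chi_H(x)\}\!\}$.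 4. If $\mathrm{BCVTree}(G)\not\simeq\mathrm{BCVTree}(H)$, or if $\mathrm{BCETree}(G)\not\simeq\mathrm{BCETree}(H)$, then $\{\!\{\chi_G(v):v\in V_G\}\!\}\ne\{\!\{\chi_H(v):v\in V_H\}\!\}$. -/

import Mathlib

namespace Biconn

/-! ### Cut vertices, cut edges, biconnected components, block cut trees -/

section Graph

variable {V : Type*}

/-- Removing the vertex `v` increases the number of connected components. -/
def IsCutVertex (G : SimpleGraph V) (v : V) : Prop :=
  Nat.card G.ConnectedComponent < Nat.card (G.induce ({v}ᶜ : Set V)).ConnectedComponent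

/-- `e` is an edge and removing it increases the number of connected components. -/
def IsCutEdge (G : SimpleGraph V) (e : Sym2 V) : Prop :=
  e ∈ G.edgeSet ∧
    Nat.card G.ConnectedComponent < Nat.card (G.deleteEdges {e}).ConnectedComponent

/-- Connected and without cut vertices. -/
def VertexBiconnected (G : SimpleGraph V) : Prop :=
  G.Connected ∧ ∀ v, ¬ IsCutVertex G v

/-- Connected and without cut edges. -/
def EdgeBiconnected (G : SimpleGraph V) : Prop :=
  G.Connected ∧ ∀ e, ¬ IsCutEdge G e

/-- The vertex-biconnected components: the inclusion-maximal vertex sets whose induced subgraph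
is vertex-biconnected. -/
def vertexBCC (G : SimpleGraph V) : Set (Set V) :=
  {S | Maximal (fun T : Set V => VertexBiconnected (G.induce T)) S}

/-- The edge-biconnected components: the inclusion-maximal vertex sets whose induced subgraph
is edge-biconnected. -/
def edgeBCC (G : SimpleGraph V) : Set (Set V) :=
  {S | Maximal (fun T : Set V => EdgeBiconnected (G.induce T)) S}

/-- Block cut-edge tree: the nodes are the edge-biconnected components, two distinct ones being
adjacent when some edge of `G` joins them. -/
def BCETree (G : SimpleGraph V) : SimpleGraph (edgeBCC G) where
  Adj S₁ S₂ := S₁ ≠ S₂ ∧ ∃ u ∈ S₁.1, ∃ v ∈ S₂.1, G.Adj u v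
  symm := ⟨fun _ _ h => ⟨h.1.symm, by
    obtain ⟨u, hu, v, hv, huv⟩ := h.2
    exact ⟨v, hv, u, hu, huv.symm⟩⟩⟩
  loopless := ⟨fun _ h => h.1 rfl⟩

/-- Block cut-vertex tree: the nodes are the vertex-biconnected components together with the cut
vertices, a component `S` and a cut vertex `v` being adjacent when `v ∈ S`; there are no other
edges. -/
def BCVTree (G : SimpleGraph V) : SimpleGraph (vertexBCC G ⊕ {v : V // IsCutVertex G v}) where
  Adj a b := (∃ S v, a = Sum.inl S ∧ b = Sum.inr v ∧ v.1 ∈ S.1) ∨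
    (∃ S v, a = Sum.inr v ∧ b = Sum.inl S ∧ v.1 ∈ S.1)
  symm := ⟨by
    rintro a b (⟨S, v, h₁, h₂, h₃⟩ | ⟨S, v, h₁, h₂, h₃⟩)
    · exact Or.inr ⟨S, v, h₂, h₁, h₃⟩
    · exact Or.inl ⟨S, v, h₂, h₁, h₃⟩⟩
  loopless := ⟨by
    rintro a (⟨S, v, h₁, h₂, -⟩ | ⟨S, v, h₁, h₂, -⟩) <;> simp [h₁] at h₂⟩

end Graph

/-! ### The 2-FWL algorithm -/

section FWL

/-- The objects that 2-FWL hashes: a `2 × 2` matrix of colors (initialization), or a pair of a color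
and a finite multiset of pairs of colors (update). -/
inductive HashInput (C : Type*) where
  | adjacency (A : Matrix (Fin 2) (Fin 2) C)
  | update (c : C) (M : Multiset (C × C))

/-- The parameters of 2-FWL: an injective hash function with values in the color set `C`, and three
different colors that encode the entries of the adjacency matrix. -/
structure ColorScheme (C : Type*) where
  hash : HashInput C → C
  hash_injective : Function.Injective hash
  cNode : C
  c₀ : C
  c₁ : C
  node_ne_c₀ : cNode ≠ c₀
  node_ne_c₁ : cNode ≠ c₁
  c₀_ne_c₁ : c₀ ≠ c₁

variable {C V : Type*} (P : ColorScheme C) (G : SimpleGraph V)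

open Classical in
/-- The color that encodes whether `u` and `v` are equal, adjacent, or neither. -/
noncomputable def pairType (u v : V) : C :=
  if u = v then P.cNode else if G.Adj u v then P.c₁ else P.c₀

/-- The 2-FWL coloring of pairs of vertices after `t` iterations. -/
noncomputable def fwl [Fintype V] : ℕ → V → V → C
  | 0, u, v => P.hash (.adjacency
      !![pairType P G u u, pairType P G u v; pairType P G v u, pairType P G v v])
  | t + 1, u, v => P.hash (.update (fwl t u v)
      (Finset.univ.val.map fun w : V => (fwl t w v, fwl t u w)))

/-- The color of a vertex is the color of the diagonal pair. -/
noncomputable def nodeColor [Fintype V] (T : ℕ) (v : V) : C := fwl P G T v v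

/-- The feature of an edge `{u, v}` is the multiset of the colors of its endpoints. -/
noncomputable def edgeFeature [Fintype V] (T : ℕ) (u v : V) : Multiset C :=
  {nodeColor P G T u, nodeColor P G T v}

/-- The representation of a graph is the multiset of its vertex colors. -/
noncomputable def graphRep [Fintype V] (T : ℕ) : Multiset C :=
  Finset.univ.val.map (nodeColor P G T)

end FWL

end Biconn

namespace Biconn

/-! ### Bijections from equal color multisets. -/

section Matching

/-! In a stable coloring of pairs, the color of `(a, b)` fixes how many `w` give each combination of
colors on `(w, b)` and `(a, w)`. By induction it fixes the number of walks of each length from `a`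
to `b`. Splitting walks at their first visit to `u` shows that the number of walks avoiding `u` is
determined by the colors of `(a, u)`, `(u, b)` and `(a, b)`. So these colors decide whether `u`
separates `a` from `b` (`reachable_deleteIncidenceSet_iff_of_color_eq`), and with it everything
defined by separation: cut vertices, cut edges, components.

Stability is needed jointly for both graphs, at some round up to `T`. The number of pair colors of
`G` grows strictly until it stabilizes and never exceeds the number of pairs. A diagonal color
shared two rounds later forces equal color sets, so the stability of `G` carries over to `H`
(`exists_fwlStable`).

Part 3 knows only the colors of the endpoints, not of the pair. If a cut edge and a non-cut edge
agreed there, `H` would contain a path `y, w, x, w'` whose outer edges are cut edges with `(y, w)`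
and `(x, w')` of the same color. The side of `y` lies properly inside that of `x`, yet the color
fixes its size (`IsCutEdge.of_vertexColor_eq`).

For part 4, a component is colored by the multiset of its vertex colors and a cut vertex by its own
color. Double counting shows that the colors determine the number of nodes, and of neighbors of a
node, of each color. Such data determine a finite forest up to isomorphism
(`nonempty_iso_of_isAcyclic_of_equitable`). -/

theorem exists_equiv_of_card_fiber_eq {α β γ : Type*} [Finite α] [Finite β] (f : α → γ) (g : β → γ)
    (h : ∀ k, Nat.card {a // f a = k} = Nat.card {b // g b = k}) :
    ∃ e : α ≃ β, ∀ x, f x = g (e x) :=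
  ⟨Equiv.ofFiberEquiv fun k => (Finite.card_eq.1 (h k)).some,
    fun x => (Equiv.ofFiberEquiv_map _ x).symm⟩

theorem card_coe_fiber_eq {α γ : Type*} [DecidableEq γ] (s : Finset α) (f : α → γ) (k : γ) :
    Nat.card {a : s // f a = k} = (s.val.map f).count k := by
  rw [Multiset.count_map]
  change _ = (s.filter fun a => k = f a).card
  rw [← Fintype.card_coe, ← Nat.card_eq_fintype_card]
  exact Nat.card_congr ((Equiv.subtypeSubtypeEquivSubtypeInter (· ∈ s) fun a => f a = k).trans
    (Equiv.subtypeEquivRight fun a => by simp [eq_comm]))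

theorem exists_equiv_of_map_val_eq {α β γ : Type*} (s : Finset α) (t : Finset β) (f : α → γ)
    (g : β → γ) (h : s.val.map f = t.val.map g) : ∃ e : s ≃ t, ∀ x : s, f x = g (e x) := by
  classical
  refine exists_equiv_of_card_fiber_eq (fun x : s => f x) (fun y : t => g y) fun k => ?_
  rw [card_coe_fiber_eq, card_coe_fiber_eq, h]

theorem exists_equiv_of_univ_map_eq {α β γ : Type*} [Fintype α] [Fintype β] (f : α → γ)
    (g : β → γ) (h : Finset.univ.val.map f = Finset.univ.val.map g) :
    ∃ e : α ≃ β, ∀ x, f x = g (e x) := by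
  obtain ⟨e, he⟩ := exists_equiv_of_map_val_eq Finset.univ Finset.univ f g h
  exact ⟨((Equiv.subtypeUnivEquiv (by simp)).symm.trans e).trans (Equiv.subtypeUnivEquiv (by simp)),
    fun x => he ⟨x, by simp⟩⟩

end Matching

/-! ### Isomorphism of equitably colored forests. -/

section Forest

variable {X Y K : Type*}

/-- Vertices of `s` that are joined by a walk are joined by a walk inside `s`. -/
def WalkClosed (F : SimpleGraph X) (s : Set X) : Prop :=
  ∀ a ∈ s, ∀ b ∈ s, F.Reachable a b → ∃ p : F.Walk a b, ∀ v ∈ p.support, v ∈ s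

/-- Otherwise `a, v, b` would be a second path besides the one inside `s`. -/
theorem WalkClosed.eq_of_adj {F : SimpleGraph X} (hF : F.IsAcyclic) {s : Set X}
    (hs : WalkClosed F s) {v a b : X} (hv : v ∉ s) (ha : a ∈ s) (hb : b ∈ s)
    (hva : F.Adj v a) (hvb : F.Adj v b) : a = b := by
  classical
  by_contra hab
  obtain ⟨p, hp⟩ := hs a ha b hb (hva.symm.reachable.trans hvb.reachable)
  have hq : (SimpleGraph.Walk.cons hva.symm (SimpleGraph.Walk.cons hvb .nil)).IsPath := by
    simp [SimpleGraph.Walk.cons_isPath_iff, hva.ne', hvb.ne, hab]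
  have := (hF.subsingleton_path a b).elim p.toPath ⟨_, hq⟩
  have hmem : v ∈ (p.toPath : F.Walk a b).support := by
    rw [this]; simp
  exact hv (hp v (p.support_toPath_subset_support hmem))

theorem WalkClosed.insert_adj {F : SimpleGraph X} {s : Set X} (hs : WalkClosed F s) {x y : X}
    (hx : x ∈ s) (hxy : F.Adj x y) : WalkClosed F (insert y s) := by
  have key : ∀ b ∈ s, F.Reachable y b → ∃ p : F.Walk y b, ∀ v ∈ p.support, v ∈ insert y s := by
    intro b hb h
    obtain ⟨p, hp⟩ := hs x hx b hb (hxy.reachable.trans h)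
    refine ⟨.cons hxy.symm p, fun v hv => ?_⟩
    rw [SimpleGraph.Walk.support_cons, List.mem_cons] at hv
    exact hv.imp id (hp v)
  rintro a (rfl | ha) b (rfl | hb) h
  · exact ⟨.nil, by simp⟩
  · exact key b hb h
  · obtain ⟨p, hp⟩ := key a ha h.symm
    exact ⟨p.reverse, by simpa using hp⟩
  · obtain ⟨p, hp⟩ := hs a ha b hb h
    exact ⟨p, fun v hv => Or.inr (hp v hv)⟩

theorem WalkClosed.insert_of_not_reachable {F : SimpleGraph X} {s : Set X} (hs : WalkClosed F s)
    {z : X} (hz : ∀ a ∈ s, ¬ F.Reachable a z) : WalkClosed F (insert z s) := by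
  rintro a (rfl | ha) b (rfl | hb) h
  · exact ⟨.nil, by simp⟩
  · exact (hz b hb h.symm).elim
  · exact (hz a ha h).elim
  · obtain ⟨p, hp⟩ := hs a ha b hb h
    exact ⟨p, fun v hv => Or.inr (hp v hv)⟩

theorem mem_of_reachable_of_forall_adj {F : SimpleGraph X} {s : Set X}
    (hs : ∀ x ∈ s, ∀ y, F.Adj x y → y ∈ s) {a b : X} (ha : a ∈ s) (h : F.Reachable a b) :
    b ∈ s := by
  obtain ⟨p⟩ := h
  induction p with
  | nil => exact ha
  | cons h p ih => exact ih (hs _ ha _ h)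

/-- A partial isomorphism that preserves colors, defined on a walk-closed set. -/
structure PartialColorIso (F : SimpleGraph X) (F' : SimpleGraph Y) (p : X → K) (q : Y → K)
    (s : Set X) (f : X → Y) : Prop where
  injOn : Set.InjOn f s
  color : ∀ x ∈ s, p x = q (f x)
  adj : ∀ x ∈ s, ∀ y ∈ s, (F.Adj x y ↔ F'.Adj (f x) (f y))
  closed : WalkClosed F s
  closed' : WalkClosed F' (f '' s)

theorem PartialColorIso.extend_by {F : SimpleGraph X} {F' : SimpleGraph Y} {p : X → K} {q : Y → K}
    {s : Set X} {f : X → Y} (h : PartialColorIso F F' p q s f) {y : X} {y' : Y} (hy : y ∉ s)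
    (hy' : y' ∉ f '' s) (hc : p y = q y') (hadj : ∀ x ∈ s, (F.Adj x y ↔ F'.Adj (f x) y'))
    (hcl : WalkClosed F (insert y s)) (hcl' : WalkClosed F' (insert y' (f '' s))) :
    ∃ g, PartialColorIso F F' p q (insert y s) g := by
  classical
  have hne : ∀ x ∈ s, x ≠ y := fun x hx hxy => hy (hxy ▸ hx)
  have hg : ∀ x ∈ s, Function.update f y y' x = f x := fun x hx =>
    Function.update_of_ne (hne x hx) _ _
  have hgy : Function.update f y y' y = y' := Function.update_self ..
  have him : Function.update f y y' '' (Insert.insert y s) = Insert.insert y' (f '' s) := by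
    rw [Set.image_insert_eq, hgy, Set.image_congr hg]
  refine ⟨Function.update f y y', ?_, ?_, ?_, hcl, him ▸ hcl'⟩
  · rw [Set.injOn_insert hy]
    exact ⟨h.injOn.congr fun x hx => (hg x hx).symm, by rwa [hgy, Set.image_congr hg]⟩
  · rintro x (rfl | hx)
    · rw [hgy, hc]
    · rw [hg x hx, h.color x hx]
  · rintro x (rfl | hx) z (rfl | hz)
    · simp
    · rw [hgy, hg z hz, F.adj_comm, F'.adj_comm, hadj z hz]
    · rw [hgy, hg x hx, hadj x hx]
    · rw [hg x hx, hg z hz, h.adj x hx z hz]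

/-- If all of `A'` were used, the images of `A` without `y` would cover it, one element too few. -/
theorem exists_image_notMem_of_ncard_eq [Finite X] [Finite Y] {s : Set X} {f : X → Y}
    {A : Set X} {A' : Set Y} (hcard : A.ncard = A'.ncard)
    (hA : ∀ x ∈ s, f x ∈ A' → x ∈ A) {y : X} (hy : y ∈ A) (hys : y ∉ s) :
    ∃ y' ∈ A', y' ∉ f '' s := by
  by_contra! hcon
  have h1 : A' ⊆ f '' (A \ {y}) := by
    intro y' hy'
    obtain ⟨x, hx, rfl⟩ := hcon y' hy'
    exact ⟨x, ⟨hA x hx hy', fun h => hys (h ▸ hx)⟩, rfl⟩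
  have h2 := (Set.ncard_le_ncard h1).trans (Set.ncard_image_le (Set.toFinite _))
  have h3 := Set.ncard_sdiff_singleton_lt_of_mem hy
  omega

theorem PartialColorIso.extend [Finite X] [Finite Y] {F : SimpleGraph X} {F' : SimpleGraph Y}
    (hF : F.IsAcyclic) (hF' : F'.IsAcyclic) {p : X → K} {q : Y → K}
    (hcount : ∀ k, {x | p x = k}.ncard = {y | q y = k}.ncard)
    (hnbr : ∀ x y, p x = q y → ∀ k,
      {z | F.Adj x z ∧ p z = k}.ncard = {z | F'.Adj y z ∧ q z = k}.ncard)
    {s : Set X} {f : X → Y} (h : PartialColorIso F F' p q s f) (hs : s ≠ Set.univ) :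
    ∃ y ∉ s, ∃ g, PartialColorIso F F' p q (insert y s) g := by
  by_cases hout : ∃ x ∈ s, ∃ y, F.Adj x y ∧ y ∉ s
  · obtain ⟨x, hx, y, hxy, hy⟩ := hout
    obtain ⟨y', ⟨hxy', hc⟩, hy'⟩ := exists_image_notMem_of_ncard_eq (s := s) (f := f)
      (hnbr x (f x) (h.color x hx) (p y))
      (fun z hz hz' => ⟨(h.adj x hx z hz).2 hz'.1, (h.color z hz).trans hz'.2⟩)
      ⟨hxy, rfl⟩ hy
    refine ⟨y, hy, h.extend_by hy hy' hc.symm (fun z hz => ⟨fun hzy => ?_, fun hzy => ?_⟩)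
      (h.closed.insert_adj hx hxy) (h.closed'.insert_adj ⟨x, hx, rfl⟩ hxy')⟩
    -- `x` is the only neighbor of `y` in `s`, and `f x` the only neighbor of `y'` in the image.
    · rwa [← h.closed.eq_of_adj hF hy hx hz hxy.symm hzy.symm]
    · have := h.closed'.eq_of_adj hF' hy' ⟨x, hx, rfl⟩ ⟨z, hz, rfl⟩ hxy'.symm hzy.symm
      rwa [← h.injOn hx hz this]
  · push Not at hout
    -- No edge leaves `s`. Since neighbor counts agree, none leaves the image either, so a new
    -- component can be started.
    have hout' : ∀ x' ∈ f '' s, ∀ y', F'.Adj x' y' → y' ∈ f '' s := by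
      rintro _ ⟨x, hx, rfl⟩ y' hxy'
      by_contra hy'
      have h1 : f '' {z | F.Adj x z ∧ p z = q y'} ⊆ {z | F'.Adj (f x) z ∧ q z = q y'} \ {y'} := by
        rintro _ ⟨z, ⟨hz, hzc⟩, rfl⟩
        have hzs := hout x hx z hz
        exact ⟨⟨(h.adj x hx z hzs).1 hz, (h.color z hzs).symm.trans hzc⟩,
          fun hh => hy' (hh ▸ ⟨z, hzs, rfl⟩)⟩
      have h2 := Set.ncard_le_ncard h1
      rw [(h.injOn.mono fun z hz => hout x hx z hz.1).ncard_image,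
        hnbr x (f x) (h.color x hx)] at h2
      have h3 := Set.ncard_sdiff_singleton_lt_of_mem
        (show y' ∈ {z | F'.Adj (f x) z ∧ q z = q y'} from ⟨hxy', rfl⟩)
      omega
    obtain ⟨z, hz⟩ := (Set.ne_univ_iff_exists_notMem s).1 hs
    obtain ⟨z', hc, hz'⟩ := exists_image_notMem_of_ncard_eq (s := s) (f := f) (hcount (p z))
      (fun x hx hx' => (h.color x hx).trans hx') rfl hz
    refine ⟨z, hz, h.extend_by hz hz' hc.symm (fun x hx => ⟨fun hh => ?_, fun hh => ?_⟩)
      (h.closed.insert_of_not_reachable fun a ha hh => ?_)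
      (h.closed'.insert_of_not_reachable fun a ha hh => ?_)⟩
    · exact (hz (hout x hx z hh)).elim
    · exact (hz' (hout' _ ⟨x, hx, rfl⟩ _ hh)).elim
    · exact hz (mem_of_reachable_of_forall_adj hout ha hh)
    · exact hz' (mem_of_reachable_of_forall_adj hout' ha hh)

/-- Finite forests with colorings that agree on the number of vertices of each color and, for
vertices of the same color, on the number of neighbors of each color, are isomorphic. -/
theorem nonempty_iso_of_isAcyclic_of_equitable [Finite X] [Finite Y] {F : SimpleGraph X}
    {F' : SimpleGraph Y} (hF : F.IsAcyclic) (hF' : F'.IsAcyclic) {p : X → K} {q : Y → K}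
    (hcount : ∀ k, {x | p x = k}.ncard = {y | q y = k}.ncard)
    (hnbr : ∀ x y, p x = q y → ∀ k,
      {z | F.Adj x z ∧ p z = k}.ncard = {z | F'.Adj y z ∧ q z = k}.ncard) :
    Nonempty (F ≃g F') := by
  obtain ⟨e, -⟩ := exists_equiv_of_card_fiber_eq p q hcount
  have key : ∀ n ≤ Nat.card X, ∃ (s : Set X) (f : X → Y), s.ncard = n ∧
      PartialColorIso F F' p q s f := by
    intro n
    induction n with
    | zero =>
      refine fun _ => ⟨∅, e, by simp, by simp, by simp, by simp, ?_, ?_⟩ <;> simp [WalkClosed]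
    | succ n ih =>
      intro hn
      obtain ⟨s, f, hs, h⟩ := ih (by omega)
      obtain ⟨y, hy, g, hg⟩ := h.extend hF hF' hcount hnbr (by
        rintro rfl
        rw [Set.ncard_univ] at hs
        omega)
      exact ⟨insert y s, g, by rw [Set.ncard_insert_of_notMem hy, hs], hg⟩
  obtain ⟨s, f, hs, h⟩ := key _ le_rfl
  obtain rfl : s = Set.univ := (Set.eq_univ_iff_ncard s).2 hs
  have hinj : Function.Injective f := Set.injOn_univ.1 h.injOn
  have hbij : Function.Bijective f :=
    (Nat.bijective_iff_injective_and_card f).2 ⟨hinj, Nat.card_congr e⟩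
  exact ⟨⟨Equiv.ofBijective f hbij, fun {a b} => (h.adj a trivial b trivial).symm⟩⟩

end Forest

/-! ### Joint stabilization of 2-FWL within `T` rounds. -/

section Stabilization

variable {C V W : Type*} (P : ColorScheme C)

theorem pairType_eq_iff {G : SimpleGraph V} {H : SimpleGraph W} {u v : V} {u' v' : W} :
    pairType P G u v = pairType P H u' v' ↔
      (u = v ↔ u' = v') ∧ (G.Adj u v ↔ H.Adj u' v') := by
  have h0 := P.node_ne_c₀
  have h1 := P.node_ne_c₁
  have h2 := P.c₀_ne_c₁
  unfold pairType
  by_cases huv : u = v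
  · subst huv
    by_cases huv' : u' = v'
    · subst huv'
      simp
    · by_cases ha' : H.Adj u' v' <;> simp [*]
  · by_cases huv' : u' = v'
    · subst huv'
      by_cases ha : G.Adj u v <;> simp [huv, ha, h0.symm, h1.symm]
    · by_cases ha : G.Adj u v <;> by_cases ha' : H.Adj u' v' <;>
        simp [huv, huv', ha, ha', h2, h2.symm]

theorem exists_equiv_apply_eq_apply_eq {a b : V} {a' b' : W} (e : V ≃ W)
    (h : a = b ↔ a' = b') : ∃ f : V ≃ W, f a = a' ∧ f b = b' := by
  classical
  by_cases hab : a = b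
  · obtain rfl := h.1 hab
    subst hab
    exact ⟨e.trans (Equiv.swap (e a) a'), by simp⟩
  · have hab' := mt h.2 hab
    let f := e.trans (Equiv.swap (e a) a')
    have hf : f a = a' := by simp [f]
    refine ⟨f.trans (Equiv.swap (f b) b'), ?_, by simp⟩
    rw [Equiv.trans_apply, hf]
    exact Equiv.swap_apply_of_ne_of_ne (fun hh => hab (f.injective (hf.trans hh))) hab'

variable [Fintype V] [Fintype W] {G : SimpleGraph V} {H : SimpleGraph W}

theorem fwl_zero_eq_iff {u v : V} {u' v' : W} :
    fwl P G 0 u v = fwl P H 0 u' v' ↔ (u = v ↔ u' = v') ∧ (G.Adj u v ↔ H.Adj u' v') := by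
  constructor
  · intro h
    have h1 := HashInput.adjacency.inj (P.hash_injective h)
    have h2 : pairType P G u v = pairType P H u' v' := by
      simpa using congrFun (congrFun h1 0) 1
    exact (pairType_eq_iff P).1 h2
  · rintro ⟨h1, h2⟩
    have h3 : pairType P G u v = pairType P H u' v' := (pairType_eq_iff P).2 ⟨h1, h2⟩
    have h4 : pairType P G v u = pairType P H v' u' :=
      (pairType_eq_iff P).2 ⟨by rw [eq_comm, h1, eq_comm], by rw [G.adj_comm, h2, H.adj_comm]⟩
    have h5 : pairType P G u u = pairType P H u' u' := (pairType_eq_iff P).2 (by simp)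
    have h6 : pairType P G v v = pairType P H v' v' := (pairType_eq_iff P).2 (by simp)
    simp only [fwl, h3, h4, h5, h6]

theorem fwl_succ_eq_iff {t : ℕ} {u v : V} {u' v' : W} :
    fwl P G (t + 1) u v = fwl P H (t + 1) u' v' ↔ fwl P G t u v = fwl P H t u' v' ∧
      ∃ e : V ≃ W, ∀ w, fwl P G t w v = fwl P H t (e w) v' ∧
        fwl P G t u w = fwl P H t u' (e w) := by
  constructor
  · intro h
    obtain ⟨h1, h2⟩ := HashInput.update.inj (P.hash_injective h)
    obtain ⟨e, he⟩ := exists_equiv_of_univ_map_eq _ _ h2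
    exact ⟨h1, e, fun w => Prod.mk.inj (he w)⟩
  · rintro ⟨h1, e, he⟩
    simp only [fwl]
    rw [h1]
    congr 2
    have h2 : (Finset.univ : Finset W).val = (Finset.univ : Finset V).val.map e := by
      rw [← Finset.map_univ_equiv e, Finset.map_val]
      rfl
    rw [h2, Multiset.map_map]
    exact Multiset.map_congr rfl fun w _ => by simp [(he w).1, (he w).2]

theorem fwl_eq_of_le {s t : ℕ} (hst : s ≤ t) {u v : V} {u' v' : W}
    (h : fwl P G t u v = fwl P H t u' v') : fwl P G s u v = fwl P H s u' v' := by
  induction hst with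
  | refl => exact h
  | step _ ih => exact ih ((fwl_succ_eq_iff P).1 h).1

theorem fwl_swap {t : ℕ} {u v : V} {u' v' : W} (h : fwl P G t u v = fwl P H t u' v') :
    fwl P G t v u = fwl P H t v' u' := by
  induction t generalizing u v u' v' with
  | zero =>
    rw [fwl_zero_eq_iff] at h ⊢
    exact ⟨by rw [eq_comm, h.1, eq_comm], by rw [G.adj_comm, h.2, H.adj_comm]⟩
  | succ t ih =>
    rw [fwl_succ_eq_iff] at h ⊢
    obtain ⟨h1, e, he⟩ := h
    exact ⟨ih h1, e, fun w => ⟨ih (he w).2, ih (he w).1⟩⟩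

/-- Between `G` and `H`, the colors after `t` iterations determine those after `t + 1`. -/
def FWLStable (G : SimpleGraph V) (H : SimpleGraph W) (t : ℕ) : Prop :=
  ∀ a b a' b', fwl P G t a b = fwl P H t a' b' → fwl P G (t + 1) a b = fwl P H (t + 1) a' b'

/-- The set of the colors of all pairs after `t` iterations. -/
def fwlColors (G : SimpleGraph V) (t : ℕ) : Set C :=
  Set.range fun p : V × V => fwl P G t p.1 p.2

theorem fwl_mem_fwlColors (t : ℕ) (a b : V) : fwl P G t a b ∈ fwlColors P G t := ⟨(a, b), rfl⟩

open Classical in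
/-- The color that the hash function has updated to a given color. -/
noncomputable def previousColor (c : C) : C :=
  if h : ∃ c' M, c = P.hash (.update c' M) then h.choose else c

theorem previousColor_fwl (t : ℕ) (a b : V) :
    previousColor P (fwl P G (t + 1) a b) = fwl P G t a b := by
  have h : ∃ c' M, fwl P G (t + 1) a b = P.hash (.update c' M) := ⟨_, _, rfl⟩
  rw [previousColor, dif_pos h]
  obtain ⟨M, hM⟩ := h.choose_spec
  exact (HashInput.update.inj (P.hash_injective hM)).1.symm

theorem image_previousColor_fwlColors (t : ℕ) :
    previousColor P '' fwlColors P G (t + 1) = fwlColors P G t := by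
  rw [fwlColors, fwlColors, ← Set.range_comp]
  exact congrArg Set.range (funext fun p => previousColor_fwl P t p.1 p.2)

/-- `previousColor` is the same map for both graphs, so injectivity on all new colors prevents pairs
of equal old color from being split, even across graphs. -/
theorem fwlStable_of_injOn {s : Set C} {t : ℕ} (hs : Set.InjOn (previousColor P) s)
    (hG : fwlColors P G (t + 1) ⊆ s) (hH : fwlColors P H (t + 1) ⊆ s) : FWLStable P G H t := by
  intro a b a' b' h
  exact hs (hG (fwl_mem_fwlColors P _ a b)) (hH (fwl_mem_fwlColors P _ a' b'))
    (by rw [previousColor_fwl, previousColor_fwl, h])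

theorem fwlColors_finite (t : ℕ) : (fwlColors P G t).Finite := Set.finite_range _

theorem ncard_fwlColors_le (t : ℕ) : (fwlColors P G t).ncard ≤ Fintype.card V ^ 2 := by
  rw [fwlColors, ← Set.image_univ]
  refine (Set.ncard_image_le Set.finite_univ).trans ?_
  rw [Set.ncard_univ, Nat.card_prod, Nat.card_eq_fintype_card, sq]

/-- The color of `(u, u)` lists the colors one round earlier of all pairs `(u, b)`, and each of
those lists the colors another round earlier of all pairs `(a, b)`. -/
theorem fwlColors_eq_of_fwl_eq {t : ℕ} {u : V} {v : W}
    (h : fwl P G (t + 2) u u = fwl P H (t + 2) v v) : fwlColors P G t = fwlColors P H t := by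
  obtain ⟨-, e, he⟩ := (fwl_succ_eq_iff P).1 h
  have h1 := fun w => (fwl_succ_eq_iff P).1 (he w).1
  apply Set.Subset.antisymm
  · rintro _ ⟨⟨a, b⟩, rfl⟩
    obtain ⟨-, e', he'⟩ := (fwl_succ_eq_iff P).1 (he b).2
    exact ⟨(e' a, e b), ((he' a).1).symm⟩
  · rintro _ ⟨⟨a, b⟩, rfl⟩
    obtain ⟨-, e', he'⟩ := (fwl_succ_eq_iff P).1 (he (e.symm b)).2
    exact ⟨(e'.symm a, e.symm b), by simpa using (he' (e'.symm a)).1⟩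

theorem fwlStable_zero_of_forall_iff (e : V ≃ W)
    (h : ∀ a b a' b', (a = b ↔ a' = b') → (G.Adj a b ↔ H.Adj a' b')) : FWLStable P G H 0 := by
  intro a b a' b' hab
  have h0 : ∀ a b a' b', (a = b ↔ a' = b') → fwl P G 0 a b = fwl P H 0 a' b' :=
    fun a b a' b' hh => (fwl_zero_eq_iff P).2 ⟨hh, h _ _ _ _ hh⟩
  obtain ⟨f, rfl, rfl⟩ := exists_equiv_apply_eq_apply_eq e ((fwl_zero_eq_iff P).1 hab).1
  exact (fwl_succ_eq_iff P).2 ⟨hab, f, fun w => ⟨h0 _ _ _ _ (by simp), h0 _ _ _ _ (by simp)⟩⟩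

/-- Starting with three colors makes up for the extra rounds spent on comparing the color sets of
the two graphs. -/
theorem three_le_ncard_fwlColors_zero {a b c d : V} (hab : G.Adj a b) (hcd : c ≠ d)
    (hcd' : ¬ G.Adj c d) : 3 ≤ (fwlColors P G 0).ncard := by
  have h1 : fwl P G 0 a a ≠ fwl P G 0 a b := fun h => by
    simpa [hab.ne] using ((fwl_zero_eq_iff P).1 h).1
  have h2 : fwl P G 0 a a ≠ fwl P G 0 c d := fun h => by
    simpa [hcd] using ((fwl_zero_eq_iff P).1 h).1
  have h3 : fwl P G 0 a b ≠ fwl P G 0 c d := fun h => by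
    simpa [hab, hcd'] using ((fwl_zero_eq_iff P).1 h).2
  rw [← Set.ncard_eq_three.2 ⟨_, _, _, h1, h2, h3, rfl⟩]
  refine Set.ncard_le_ncard ?_ (fwlColors_finite P 0)
  rintro _ (rfl | rfl | rfl) <;> exact fwl_mem_fwlColors P _ _ _

/-- After as many iterations as there are pairs of vertices, vertices of `G` and `H` with the same
color have already had the same color in a stable coloring. -/
theorem exists_fwlStable {T : ℕ} (hG : Fintype.card V ^ 2 ≤ T) {u : V} {v : W}
    (h : fwl P G T u u = fwl P H T v v) :
    ∃ t ≤ T, FWLStable P G H t ∧ FWLStable P G G t ∧ FWLStable P H H t := by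
  have hcol : ∀ s, s + 2 ≤ T → fwlColors P G s = fwlColors P H s := fun s hs =>
    fwlColors_eq_of_fwl_eq P (fwl_eq_of_le P hs h)
  have hpos : 0 < Fintype.card V := Fintype.card_pos_iff.2 ⟨u⟩
  obtain ⟨e, -⟩ : ∃ e : V ≃ W, True := by
    obtain ⟨T, rfl⟩ : ∃ T', T = T' + 1 := ⟨T - 1, by have := Nat.pow_pos (n := 2) hpos; omega⟩
    exact ⟨((fwl_succ_eq_iff P).1 h).2.choose, trivial⟩
  -- If `G` is complete or edgeless, three initial colors are not available, but round 0 is already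
  -- stable.
  by_cases hmix : (∃ a b, G.Adj a b) ∧ ∃ c d, c ≠ d ∧ ¬ G.Adj c d
  · obtain ⟨⟨a, b, hab⟩, c, d, hcd, hcd'⟩ := hmix
    have h3 := three_le_ncard_fwlColors_zero P hab hcd hcd'
    have hle := ncard_fwlColors_le P (G := G) 0
    have hmono : ∀ s, (fwlColors P G s).ncard ≤ (fwlColors P G (s + 1)).ncard := fun s => by
      rw [← image_previousColor_fwlColors P s]
      exact Set.ncard_image_le (fwlColors_finite P _)
    -- The color sets after `s + 1` rounds agree if `s + 3 ≤ T`. Without such an `s`, round `T - 2`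
    -- would have at least `T + 1` colors, more than there are pairs.
    obtain ⟨s, hs, hs'⟩ : ∃ s, s + 3 ≤ T ∧
        (fwlColors P G s).ncard = (fwlColors P G (s + 1)).ncard := by
      by_contra! hcon
      have : ∀ s, s + 2 ≤ T → s + 3 ≤ (fwlColors P G s).ncard := by
        intro s
        induction s with
        | zero => exact fun _ => h3
        | succ s ih =>
          intro hs
          have := hcon s (by omega)
          have := hmono s
          have := ih (by omega)
          omega
      have := this (T - 2) (by omega)
      have := ncard_fwlColors_le P (G := G) (T - 2)
      omega
    have hinj : Set.InjOn (previousColor P) (fwlColors P G (s + 1)) := by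
      apply Set.injOn_of_ncard_image_eq _ (fwlColors_finite P _)
      rw [image_previousColor_fwlColors, hs']
    have hGH := hcol (s + 1) (by omega)
    exact ⟨s, by omega, fwlStable_of_injOn P hinj le_rfl hGH.ge,
      fwlStable_of_injOn P hinj le_rfl le_rfl, fwlStable_of_injOn P hinj hGH.ge hGH.ge⟩
  · have hGG : ∀ a b a' b', (a = b ↔ a' = b') → (G.Adj a b ↔ G.Adj a' b') := by
      intro a b a' b' hh
      by_cases hab : a = b
      · have := hh.1 hab
        subst hab this
        simp
      · have hab' := mt hh.2 hab
        by_contra hne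
        apply hmix
        by_cases hadj : G.Adj a b
        · exact ⟨⟨a, b, hadj⟩, a', b', hab', fun h' => hne (iff_of_true hadj h')⟩
        · refine ⟨⟨a', b', ?_⟩, a, b, hab, hadj⟩
          by_contra h'
          exact hne (iff_of_false hadj h')
    have hGH : ∀ a b a' b', (a = b ↔ a' = b') → (G.Adj a b ↔ H.Adj a' b') := by
      intro a b a' b' hh
      by_cases hab : a = b
      · have := hh.1 hab
        subst hab this
        simp
      · have h2 : 2 ≤ Fintype.card V := by
          have := Fintype.one_lt_card_iff.2 ⟨a, b, hab⟩
          omega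
        have hT : 0 + 2 ≤ T := by nlinarith
        have hmem := fwl_mem_fwlColors P (G := H) 0 a' b'
        rw [← hcol 0 hT] at hmem
        obtain ⟨⟨c, d⟩, hcd⟩ := hmem
        obtain ⟨h4, h5⟩ := (fwl_zero_eq_iff P).1 hcd
        rw [← h5]
        exact hGG _ _ _ _ (hh.trans h4.symm)
    have hHH : ∀ a b a' b', (a = b ↔ a' = b') → (H.Adj a b ↔ H.Adj a' b') := by
      intro a b a' b' hh
      rw [← hGH (e.symm a) (e.symm b) a b (by simp), hGH]
      simpa using hh
    exact ⟨0, Nat.zero_le _, fwlStable_zero_of_forall_iff P e hGH,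
      fwlStable_zero_of_forall_iff P (Equiv.refl _) hGG,
      fwlStable_zero_of_forall_iff P (Equiv.refl _) hHH⟩

end Stabilization

/-! ### Walk counts and first passage. -/

section WalkCount

variable {V : Type*}

open Classical in
/-- The number of walks of length `k` from `a` to `b`. -/
noncomputable def walkCount [Fintype V] (G : SimpleGraph V) : ℕ → V → V → ℕ
  | 0, a, b => if a = b then 1 else 0
  | k + 1, a, b => ∑ w, if G.Adj a w then walkCount G k w b else 0

open Classical in
/-- The number of walks of length `k` from `a` to `u` that visit `u` only at the end. -/
noncomputable def firstPassageCount [Fintype V] (G : SimpleGraph V) (u : V) : ℕ → V → ℕ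
  | 0, a => if a = u then 1 else 0
  | k + 1, a => if a = u then 0 else
      ∑ w, if G.Adj a w then firstPassageCount G u k w else 0

theorem exists_walkCount_pos_iff [Fintype V] {G : SimpleGraph V} {a b : V} :
    (∃ k, 0 < walkCount G k a b) ↔ G.Reachable a b := by
  constructor
  · rintro ⟨k, hk⟩
    induction k generalizing a with
    | zero =>
      by_cases hab : a = b
      · exact hab ▸ .rfl
      · simp [walkCount, hab] at hk
    | succ k ih =>
      obtain ⟨w, -, hw⟩ := Finset.exists_ne_zero_of_sum_ne_zero hk.ne'
      by_cases haw : G.Adj a w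
      · rw [if_pos haw] at hw
        exact haw.reachable.trans (ih (Nat.pos_of_ne_zero hw))
      · simp [haw] at hw
  · rintro ⟨p⟩
    induction p with
    | nil => exact ⟨0, by simp [walkCount]⟩
    | @cons a w b h p ih =>
      obtain ⟨k, hk⟩ := ih
      refine ⟨k + 1, Finset.sum_pos' (fun _ _ => Nat.zero_le _) ⟨w, Finset.mem_univ _, ?_⟩⟩
      rwa [if_pos h]

/-- A walk to `b` either avoids `u` or has a first visit of `u`. -/
theorem walkCount_eq_add_sum_firstPassageCount [Fintype V] (G : SimpleGraph V) {u b : V}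
    (hb : b ≠ u) (k : ℕ) (a : V) :
    walkCount G k a b = walkCount (G.deleteIncidenceSet u) k a b +
      ∑ j ∈ Finset.HasAntidiagonal.antidiagonal k, firstPassageCount G u j.1 a * walkCount G j.2 u b := by
  classical
  have hdel : ∀ k, walkCount (G.deleteIncidenceSet u) k u b = 0 := by
    intro k
    cases k with
    | zero => simp [walkCount, hb.symm]
    | succ k => simp [walkCount, SimpleGraph.deleteIncidenceSet_adj]
  induction k generalizing a with
  | zero =>
    by_cases ha : a = u
    · subst ha; simp [walkCount, firstPassageCount, hb.symm]
    · simp [walkCount, firstPassageCount, ha]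
  | succ k ih =>
    by_cases ha : a = u
    · subst ha
      rw [hdel, Finset.Nat.sum_antidiagonal_succ]
      simp [firstPassageCount]
    · rw [Finset.Nat.sum_antidiagonal_succ]
      have h1 : walkCount (G.deleteIncidenceSet u) (k + 1) a b =
          ∑ w, if G.Adj a w then walkCount (G.deleteIncidenceSet u) k w b else 0 := by
        simp only [walkCount]
        refine Finset.sum_congr rfl fun w _ => ?_
        by_cases hw : w = u
        · subst hw; simp [hdel]
        · simp [SimpleGraph.deleteIncidenceSet_adj, ha, hw]
      rw [h1]
      -- First passage at time 0 is impossible as `a ≠ u`; everything else is split by the first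
      -- step `w`.
      simp only [walkCount, firstPassageCount, ha, if_false, zero_mul, zero_add, Finset.sum_mul]
      rw [Finset.sum_comm, ← Finset.sum_add_distrib]
      refine Finset.sum_congr rfl fun w _ => ?_
      by_cases hw : G.Adj a w
      · simp only [hw, if_true]
        exact ih w
      · simp [hw]

end WalkCount

/-! ### What stable pair colors determine. -/

section Coherent

variable {C A B : Type*}

/-- Colorings of the pairs of vertices of two vertex sets that are jointly stable under 2-FWL. -/
structure CoherentPair (c : A → A → C) (c' : B → B → C) : Prop where
  diag : ∀ {u v u' v'}, c u v = c' u' v' → (u = v ↔ u' = v')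
  swap : ∀ {u v u' v'}, c u v = c' u' v' → c v u = c' v' u'
  exists_equiv : ∀ {u v u' v'}, c u v = c' u' v' →
    ∃ e : A ≃ B, ∀ w, c w v = c' (e w) v' ∧ c u w = c' u' (e w)

/-- The coloring determines adjacency. -/
def AdjCompatible (c : A → A → C) (c' : B → B → C) (G : SimpleGraph A) (H : SimpleGraph B) :
    Prop :=
  ∀ {u v u' v'}, c u v = c' u' v' → (G.Adj u v ↔ H.Adj u' v')

theorem FWLStable.coherentPair [Fintype A] [Fintype B] {P : ColorScheme C} {G : SimpleGraph A}
    {H : SimpleGraph B} {t : ℕ} (h : FWLStable P G H t) :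
    CoherentPair (fwl P G t) (fwl P H t) where
  diag h' := ((fwl_zero_eq_iff P).1 (fwl_eq_of_le P (Nat.zero_le t) h')).1
  swap h' := fwl_swap P h'
  exists_equiv h' := ((fwl_succ_eq_iff P).1 (h _ _ _ _ h')).2

theorem adjCompatible_fwl [Fintype A] [Fintype B] {P : ColorScheme C} {G : SimpleGraph A}
    {H : SimpleGraph B} {t : ℕ} : AdjCompatible (fwl P G t) (fwl P H t) G H :=
  fun h => ((fwl_zero_eq_iff P).1 (fwl_eq_of_le P (Nat.zero_le t) h)).2

variable {c : A → A → C} {c' : B → B → C} {G : SimpleGraph A} {H : SimpleGraph B}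

theorem CoherentPair.symm (h : CoherentPair c c') : CoherentPair c' c where
  diag hh := (h.diag hh.symm).symm
  swap hh := (h.swap hh.symm).symm
  exists_equiv hh := by
    obtain ⟨e, he⟩ := h.exists_equiv hh.symm
    exact ⟨e.symm, fun w => ⟨by simpa using (he (e.symm w)).1.symm,
      by simpa using (he (e.symm w)).2.symm⟩⟩

theorem AdjCompatible.symm (h : AdjCompatible c c' G H) : AdjCompatible c' c H G :=
  fun hh => (h hh.symm).symm

/-- The bijection sends `v` to a vertex forming a diagonal pair with `v'`, hence to `v'`. -/
theorem CoherentPair.diag_right (h : CoherentPair c c') {u v : A} {u' v' : B}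
    (hc : c u v = c' u' v') : c v v = c' v' v' := by
  obtain ⟨e, he⟩ := h.exists_equiv hc
  have h1 := (he v).1
  rwa [(h.diag h1).1 rfl] at h1

/-- The bijection matches first steps `w`, preserving adjacency of `(a, w)` and the color of `(w,
b)`, to which induction applies. -/
theorem walkCount_eq_of_color_eq [Fintype A] [Fintype B] (h : CoherentPair c c')
    (hadj : AdjCompatible c c' G H) {a b : A} {a' b' : B} (hab : c a b = c' a' b') (k : ℕ) :
    walkCount G k a b = walkCount H k a' b' := by
  classical
  induction k generalizing a b a' b' with
  | zero => simp only [walkCount, h.diag hab]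
  | succ k ih =>
    obtain ⟨e, he⟩ := h.exists_equiv hab
    simp only [walkCount]
    rw [← e.sum_comp]
    exact Finset.sum_congr rfl fun w _ => by simp only [hadj (he w).2, ih (he w).1]

theorem firstPassageCount_eq_of_color_eq [Fintype A] [Fintype B] (h : CoherentPair c c')
    (hadj : AdjCompatible c c' G H) {a u : A} {a' u' : B} (hau : c a u = c' a' u') (k : ℕ) :
    firstPassageCount G u k a = firstPassageCount H u' k a' := by
  classical
  induction k generalizing a a' with
  | zero => simp only [firstPassageCount, h.diag hau]
  | succ k ih =>
    obtain ⟨e, he⟩ := h.exists_equiv hau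
    simp only [firstPassageCount, h.diag hau]
    rw [← e.sum_comp]
    exact if_congr Iff.rfl rfl
      (Finset.sum_congr rfl fun w _ => by simp only [hadj (he w).2, ih (he w).1])

variable [Finite A] [Finite B]

theorem reachable_iff_of_color_eq (h : CoherentPair c c') (hadj : AdjCompatible c c' G H)
    {a b : A} {a' b' : B} (hab : c a b = c' a' b') : G.Reachable a b ↔ H.Reachable a' b' := by
  cases nonempty_fintype A
  cases nonempty_fintype B
  simp only [← exists_walkCount_pos_iff, walkCount_eq_of_color_eq h hadj hab]

/-- The colors of the three pairs decide whether `u` separates `a` from `b`. -/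
theorem reachable_deleteIncidenceSet_iff_of_color_eq (h : CoherentPair c c')
    (hadj : AdjCompatible c c' G H) {a u b : A} {a' u' b' : B} (hau : c a u = c' a' u')
    (hub : c u b = c' u' b') (hab : c a b = c' a' b') (hb : b ≠ u) :
    (G.deleteIncidenceSet u).Reachable a b ↔ (H.deleteIncidenceSet u').Reachable a' b' := by
  cases nonempty_fintype A
  cases nonempty_fintype B
  have hb' : b' ≠ u' := fun hh => hb ((h.diag hub).2 hh.symm).symm
  simp only [← exists_walkCount_pos_iff]
  refine exists_congr fun k => ?_
  have h1 := walkCount_eq_add_sum_firstPassageCount G hb k a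
  have h2 := walkCount_eq_add_sum_firstPassageCount H hb' k a'
  simp only [walkCount_eq_of_color_eq h hadj hab, walkCount_eq_of_color_eq h hadj hub,
    firstPassageCount_eq_of_color_eq h hadj hau] at h1
  -- Equal totals minus equal numbers of walks through `u`.
  have : walkCount (G.deleteIncidenceSet u) k a b = walkCount (H.deleteIncidenceSet u') k a' b' := by
    omega
  rw [this]

end Coherent

/-! ### Cut vertices as separators. -/

section CutVertex

variable {V : Type*} {G : SimpleGraph V}

theorem reachable_deleteIncidenceSet_of_not_mem_support {u a b : V} (p : G.Walk a b)
    (hp : u ∉ p.support) : (G.deleteIncidenceSet u).Reachable a b := by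
  induction p with
  | nil => exact .rfl
  | cons h p ih =>
    simp only [SimpleGraph.Walk.support_cons, List.mem_cons, not_or] at hp
    refine SimpleGraph.Reachable.trans (SimpleGraph.Adj.reachable ?_) (ih hp.2)
    exact SimpleGraph.deleteIncidenceSet_adj.2
      ⟨h, fun hh => hp.1 hh.symm, fun hh => hp.2 (hh ▸ p.start_mem_support)⟩

theorem not_mem_support_of_walk_deleteIncidenceSet {u a b : V}
    (p : (G.deleteIncidenceSet u).Walk a b) (ha : a ≠ u) : u ∉ p.support := by
  induction p with
  | nil => simpa using ha.symm
  | cons h p ih =>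
    have := SimpleGraph.deleteIncidenceSet_adj.1 h
    simp only [SimpleGraph.Walk.support_cons, List.mem_cons, not_or]
    exact ⟨ha.symm, ih this.2.2⟩

theorem reachable_induce_compl_iff {u : V} {a b : ({u}ᶜ : Set V)} :
    (G.induce ({u}ᶜ : Set V)).Reachable a b ↔ (G.deleteIncidenceSet u).Reachable a.1 b.1 := by
  constructor
  · intro h
    refine h.map (⟨Subtype.val, fun {x y} hxy => ?_⟩ :
      G.induce ({u}ᶜ : Set V) →g G.deleteIncidenceSet u)
    exact SimpleGraph.deleteIncidenceSet_adj.2 ⟨hxy, x.2, y.2⟩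
  · rintro ⟨p⟩
    have hp : ∀ x ∈ p.support, x ∈ ({u}ᶜ : Set V) := fun x hx hxu =>
      not_mem_support_of_walk_deleteIncidenceSet p a.2 (hxu ▸ hx)
    have h := (p.induce _ hp).reachable
    rwa [SimpleGraph.induce_deleteIncidenceSet_of_notMem _ (by simp)] at h

/-- `f` induces a surjection on components, so the count grows exactly when this is not injective.
-/
theorem card_connectedComponent_lt_iff {W : Type*} [Finite W] {H : SimpleGraph W} (f : H →g G)
    (hf : ∀ v, ∃ w, G.Reachable (f w) v) :
    Nat.card G.ConnectedComponent < Nat.card H.ConnectedComponent ↔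
      ∃ a b, G.Reachable (f a) (f b) ∧ ¬ H.Reachable a b := by
  have hsurj : Function.Surjective (SimpleGraph.ConnectedComponent.map f) := by
    intro C
    induction C using SimpleGraph.ConnectedComponent.ind with
    | _ v =>
      obtain ⟨w, hw⟩ := hf v
      exact ⟨H.connectedComponentMk w, by simpa using hw⟩
  have hinj : Function.Injective (SimpleGraph.ConnectedComponent.map f) ↔
      ∀ a b, G.Reachable (f a) (f b) → H.Reachable a b := by
    constructor
    · intro h a b hab
      exact SimpleGraph.ConnectedComponent.exact (h (by simpa using hab))
    · intro h C D
      refine SimpleGraph.ConnectedComponent.ind₂ (fun a b hab => ?_) C D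
      exact SimpleGraph.ConnectedComponent.sound (h a b (by simpa using hab))
  have hle := Nat.card_le_card_of_surjective _ hsurj
  constructor
  · intro hlt
    by_contra! hcon
    have := Nat.card_congr (Equiv.ofBijective _ ⟨hinj.2 hcon, hsurj⟩)
    omega
  · rintro ⟨a, b, hab, hab'⟩
    refine lt_of_le_of_ne hle fun heq => hab' (hinj.1 ?_ a b hab)
    have : Finite G.ConnectedComponent := Finite.of_surjective _ hsurj
    exact ((Nat.bijective_iff_surjective_and_card _).2 ⟨hsurj, heq.symm⟩).1

theorem isCutVertex_iff [Finite V] {u : V} : IsCutVertex G u ↔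
    ∃ a b, a ≠ u ∧ b ≠ u ∧ G.Reachable a b ∧ ¬ (G.deleteIncidenceSet u).Reachable a b := by
  let f : G.induce ({u}ᶜ : Set V) →g G := (SimpleGraph.Embedding.induce _).toHom
  by_cases hu : ∃ a, a ≠ u ∧ G.Reachable a u
  · obtain ⟨a, hau, ha⟩ := hu
    have hf : ∀ v, ∃ w, G.Reachable (f w) v := fun v => by
      by_cases hv : v = u
      · exact ⟨⟨a, hau⟩, hv ▸ ha⟩
      · exact ⟨⟨v, hv⟩, .rfl⟩
    rw [IsCutVertex, card_connectedComponent_lt_iff f hf]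
    simp only [reachable_induce_compl_iff]
    constructor
    · rintro ⟨a, b, h1, h2⟩
      exact ⟨a, b, a.2, b.2, h1, h2⟩
    · rintro ⟨a, b, ha, hb, h1, h2⟩
      exact ⟨⟨a, ha⟩, ⟨b, hb⟩, h1, h2⟩
  -- An isolated `u` separates nothing, and deleting it cannot increase the count.
  · push Not at hu
    have hdel : ∀ a b, a ≠ u → G.Reachable a b → (G.deleteIncidenceSet u).Reachable a b := by
      classical
      rintro a b ha ⟨p⟩
      exact reachable_deleteIncidenceSet_of_not_mem_support p fun hp =>
        hu a ha (p.takeUntil u hp).reachable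
    constructor
    · intro h
      refine absurd h (not_lt.2 (Nat.card_le_card_of_injective
        (SimpleGraph.ConnectedComponent.map f) fun C D => ?_))
      refine SimpleGraph.ConnectedComponent.ind₂ (fun a b hab => ?_) C D
      refine SimpleGraph.ConnectedComponent.sound (reachable_induce_compl_iff.2 ?_)
      exact hdel _ _ a.2 (SimpleGraph.ConnectedComponent.exact hab)
    · rintro ⟨a, b, ha, -, h1, h2⟩
      exact (h2 (hdel a b ha h1)).elim

end CutVertex

/-! ### Cut edges and their sides. -/

section CutEdge

variable {V : Type*} {G : SimpleGraph V}

theorem isCutEdge_iff_isBridge [Finite V] {a b : V} :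
    IsCutEdge G s(a, b) ↔ G.Adj a b ∧ G.IsBridge s(a, b) := by
  rw [IsCutEdge, SimpleGraph.mem_edgeSet]
  refine and_congr_right fun hadj => ?_
  let f : G.deleteEdges {s(a, b)} →g G := .ofLE (SimpleGraph.deleteEdges_le _)
  rw [card_connectedComponent_lt_iff f fun v => ⟨v, .rfl⟩, SimpleGraph.isBridge_iff]
  constructor
  · rintro ⟨x, y, ⟨p⟩, h2⟩ h3
    refine h2 ?_
    change G.Walk x y at p
    clear h2
    induction p with
    | nil => exact .rfl
    | @cons x z y h p ih =>
      refine SimpleGraph.Reachable.trans ?_ ih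
      by_cases hxz : s(x, z) = s(a, b)
      · rcases Sym2.eq_iff.1 hxz with ⟨rfl, rfl⟩ | ⟨rfl, rfl⟩
        · exact h3
        · exact h3.symm
      · exact SimpleGraph.Adj.reachable (SimpleGraph.deleteEdges_adj.2 ⟨h, hxz⟩)
  · intro h
    exact ⟨a, b, hadj.reachable, h⟩

/-- An edge `{y, w}` is a cut edge when `y` separates its other neighbors from `w`. -/
theorem isCutEdge_iff [Finite V] {y w : V} : IsCutEdge G s(y, w) ↔ G.Adj y w ∧
    ∀ z, G.Adj y z → z ≠ w → ¬ (G.deleteIncidenceSet y).Reachable z w := by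
  classical
  rw [isCutEdge_iff_isBridge, SimpleGraph.isBridge_iff]
  refine and_congr_right fun hadj => ⟨fun h z hz hzw hr => h ?_, fun h hr => ?_⟩
  · refine SimpleGraph.Reachable.trans (v := z) (SimpleGraph.Adj.reachable ?_) (hr.mono ?_)
    · refine SimpleGraph.deleteEdges_adj.2 ⟨hz, fun hh => ?_⟩
      rcases Sym2.eq_iff.1 hh with ⟨-, rfl⟩ | ⟨rfl, -⟩
      · exact hzw rfl
      · exact hadj.ne rfl
    · intro a b hab
      obtain ⟨h1, h2, h3⟩ := SimpleGraph.deleteIncidenceSet_adj.1 hab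
      refine SimpleGraph.deleteEdges_adj.2 ⟨h1, fun hh => ?_⟩
      rcases Sym2.eq_iff.1 hh with ⟨rfl, -⟩ | ⟨-, rfl⟩
      · exact h2 rfl
      · exact h3 rfl
  -- A path from `y` to `w` without the edge leaves `y` through another neighbor and never returns.
  · obtain ⟨p, hp⟩ := hr.exists_isPath
    cases p with
    | nil => exact hadj.ne rfl
    | @cons _ z _ hyz p =>
      obtain ⟨h1, h2⟩ := SimpleGraph.deleteEdges_adj.1 hyz
      refine h z h1 (fun hh => h2 (by rw [hh]; rfl)) ?_
      have h3 := ((SimpleGraph.Walk.cons_isPath_iff _ _).1 hp).2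
      refine reachable_deleteIncidenceSet_of_not_mem_support
        (p.mapLe (SimpleGraph.deleteEdges_le _)) ?_
      simpa using h3

theorem IsCutEdge.adj {a b : V} (h : IsCutEdge G s(a, b)) : G.Adj a b := h.1

/-- The vertices on the side of `y` of a cut edge `{y, w}`. -/
def edgeSide (G : SimpleGraph V) (y w : V) : Set V :=
  {z | G.Reachable y z ∧ (z = y ∨ ¬ (G.deleteIncidenceSet y).Reachable z w)}

/-- If the walk avoiding `x` met `y`, its remainder would join `y` to `b` without `x`. -/
theorem reachable_deleteIncidenceSet_of_not_reachable {x y a b : V}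
    (h : (G.deleteIncidenceSet x).Reachable a b)
    (hy : ¬ (G.deleteIncidenceSet x).Reachable y b) : (G.deleteIncidenceSet y).Reachable a b := by
  classical
  obtain ⟨p⟩ := h
  refine reachable_deleteIncidenceSet_of_not_mem_support
    (p.mapLe (G.deleteIncidenceSet_le x)) fun hmem => ?_
  rw [SimpleGraph.Walk.support_mapLe_eq_support] at hmem
  exact hy (p.dropUntil y hmem).reachable

theorem reachable_deleteIncidenceSet_of_adj {u a b : V} (h : G.Adj a b) (ha : a ≠ u)
    (hb : b ≠ u) : (G.deleteIncidenceSet u).Reachable a b :=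
  (SimpleGraph.deleteIncidenceSet_adj.2 ⟨h, ha, hb⟩).reachable

/-- On a path `y, w, x, w'` whose outer edges are cut edges, the side of `y` is properly contained
in the side of `x`. -/
theorem edgeSide_ssubset [Finite V] {w x y w' : V} (hyw : IsCutEdge G s(y, w))
    (hxw' : IsCutEdge G s(x, w')) (hwx : G.Adj w x) (hxy : x ≠ y) (hww' : w ≠ w') :
    edgeSide G y w ⊂ edgeSide G x w' := by
  obtain ⟨hyw1, hyw2⟩ := isCutEdge_iff.1 hyw
  obtain ⟨hxw1, hxw2⟩ := isCutEdge_iff.1 hxw'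
  have hw : ¬ (G.deleteIncidenceSet x).Reachable w w' := hxw2 w hwx.symm hww'
  have hy : ¬ (G.deleteIncidenceSet x).Reachable y w' := fun h =>
    hw ((reachable_deleteIncidenceSet_of_adj hyw1.symm hwx.ne hxy.symm).trans h)
  refine (Set.ssubset_iff_of_subset ?_).2 ⟨x, ⟨.rfl, Or.inl rfl⟩, fun hx => ?_⟩
  · rintro z ⟨hz, hz'⟩
    refine ⟨(hwx.symm.reachable.trans hyw1.symm.reachable).trans hz, ?_⟩
    by_contra! hcon
    obtain ⟨-, hzw'⟩ := hcon
    have hzy : z ≠ y := fun hh => hy (hh ▸ hzw')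
    refine (hz'.resolve_left hzy) ?_
    have hw'y : w' ≠ y := fun hh => hy (hh ▸ .rfl)
    -- The walk from `z` to `w'` avoiding `x` also avoids `y`; continued through `x` to `w`, it
    -- contradicts that `y` separates `z` from `w`.
    exact ((reachable_deleteIncidenceSet_of_not_reachable hzw' hy).trans
      (reachable_deleteIncidenceSet_of_adj hxw1.symm hw'y hxy)).trans
      (reachable_deleteIncidenceSet_of_adj hwx.symm hxy hyw1.ne')
  · exact hx.2.elim hxy fun h => h (reachable_deleteIncidenceSet_of_adj hwx.symm hxy hyw1.ne')

end CutEdge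

/-! ### Cut vertices, cut edges and connectedness from colors. -/

section Color

variable {C A B : Type*} {c : A → A → C} {c' : B → B → C} {G : SimpleGraph A} {H : SimpleGraph B}

/-- Extend a pair to a triple with the same colors. -/
theorem CoherentPair.exists_triple (h : CoherentPair c c') {u v : A} {u' v' : B}
    (hc : c u v = c' u' v') (w : A) : ∃ w', c u w = c' u' w' ∧ c v w = c' v' w' := by
  obtain ⟨e, he⟩ := h.exists_equiv hc
  exact ⟨e w, (he w).2, h.swap (he w).1⟩

variable [Finite A] [Finite B]

theorem IsCutVertex.of_color_eq (h : CoherentPair c c') (hadj : AdjCompatible c c' G H) {u : A}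
    {v : B} (hc : c u u = c' v v) (hu : IsCutVertex G u) : IsCutVertex H v := by
  rw [isCutVertex_iff] at hu ⊢
  obtain ⟨a, b, ha, hb, hab, hsep⟩ := hu
  obtain ⟨a', ha', -⟩ := h.exists_triple hc a
  obtain ⟨b', hb', hab'⟩ := h.exists_triple ha' b
  refine ⟨a', b', fun hh => ha ((h.diag ha').2 hh.symm).symm,
    fun hh => hb ((h.diag hb').2 hh.symm).symm, (reachable_iff_of_color_eq h hadj hab').1 hab, ?_⟩
  rwa [← reachable_deleteIncidenceSet_iff_of_color_eq h hadj (h.swap ha') hb' hab' hb]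

theorem isCutVertex_iff_of_color_eq (h : CoherentPair c c') (hadj : AdjCompatible c c' G H) {u : A}
    {v : B} (hc : c u u = c' v v) : IsCutVertex G u ↔ IsCutVertex H v :=
  ⟨.of_color_eq h hadj hc, .of_color_eq h.symm hadj.symm hc.symm⟩

theorem IsCutEdge.of_color_eq (h : CoherentPair c c') (hadj : AdjCompatible c c' G H) {y w : A}
    {y' w' : B} (hc : c y w = c' y' w') (he : IsCutEdge G s(y, w)) : IsCutEdge H s(y', w') := by
  rw [isCutEdge_iff] at he ⊢
  refine ⟨(hadj hc).1 he.1, fun z' hz' hzw' hr => ?_⟩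
  obtain ⟨z, hz1, hz2⟩ := h.symm.exists_triple hc.symm z'
  refine he.2 z ((hadj hz1.symm).2 hz')
    (fun hh => hzw' ((h.diag hz2.symm).1 hh.symm).symm) ?_
  rwa [reachable_deleteIncidenceSet_iff_of_color_eq h hadj (h.swap hz1.symm) hc
    (h.swap hz2.symm) he.1.ne']

theorem isCutEdge_iff_of_color_eq (h : CoherentPair c c') (hadj : AdjCompatible c c' G H) {y w : A}
    {y' w' : B} (hc : c y w = c' y' w') : IsCutEdge G s(y, w) ↔ IsCutEdge H s(y', w') :=
  ⟨.of_color_eq h hadj hc, .of_color_eq h.symm hadj.symm hc.symm⟩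

theorem ncard_edgeSide_eq_of_color_eq (h : CoherentPair c c') (hadj : AdjCompatible c c' G H)
    {y w : A} {y' w' : B} (hc : c y w = c' y' w') (hyw : y ≠ w) :
    (edgeSide G y w).ncard = (edgeSide H y' w').ncard := by
  obtain ⟨e, he⟩ := h.exists_equiv hc
  rw [← Set.ncard_image_of_injective _ e.injective, Equiv.image_eq_preimage_symm]
  congr 1
  ext z'
  obtain ⟨z, rfl⟩ := e.surjective z'
  obtain ⟨hz1, hz2⟩ := he z
  simp only [Set.mem_preimage, Equiv.symm_apply_apply, edgeSide, Set.mem_ofPred_eq,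
    reachable_iff_of_color_eq h hadj hz2, h.diag (h.swap hz2),
    reachable_deleteIncidenceSet_iff_of_color_eq h hadj (h.swap hz2) hc hz1 hyw.symm]

/-- Whether an edge is a cut edge is determined by the colors of its end vertices. -/
theorem IsCutEdge.of_vertexColor_eq (h : CoherentPair c c') (h' : CoherentPair c' c')
    (hadj : AdjCompatible c c' G H) (hadj' : AdjCompatible c' c' H H) {u v : A} {w x : B}
    (huw : c u u = c' w w) (hvx : c v v = c' x x) (he : IsCutEdge G s(u, v)) (hwx : H.Adj w x) :
    IsCutEdge H s(w, x) := by
  by_contra hcon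
  -- `(w, y)` copies `(u, v)`, so `{w, y}` is a cut edge and `y` has the color of `x`.
  obtain ⟨y, hy, -⟩ := h.exists_triple huw v
  have hwy := he.of_color_eq h hadj hy
  have hxy : x ≠ y := fun hh => hcon (hh ▸ hwy)
  -- As `x` and `y` have the same color, `x` has a partner `w'` copying the pair `(y, w)`.
  obtain ⟨w', hw', -⟩ := h'.exists_triple ((h.diag_right hy).symm.trans hvx) w
  have hyw : IsCutEdge H s(y, w) := Sym2.eq_swap ▸ hwy
  have hxw' := hyw.of_color_eq h' hadj' hw'
  have hne : w ≠ w' := fun hh => hcon (Sym2.eq_swap ▸ hh ▸ hxw')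
  have h1 := Set.ncard_lt_ncard (edgeSide_ssubset hyw hxw' hwx hxy hne)
  exact h1.ne (ncard_edgeSide_eq_of_color_eq h' hadj' hw' hyw.adj.ne)

theorem connected_of_color_eq (h : CoherentPair c c') (hadj : AdjCompatible c c' G H)
    {u : A} {v : B} (hc : c u u = c' v v) (hG : G.Connected) : H.Connected := by
  refine (SimpleGraph.connected_iff_exists_forall_reachable H).2 ⟨v, fun w => ?_⟩
  obtain ⟨w', hw', -⟩ := h.symm.exists_triple hc.symm w
  exact (reachable_iff_of_color_eq h hadj hw'.symm).1 (hG.preconnected u w')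

end Color

/-! ### Counting by fibers and along bijections. -/

section Counting

variable {α β γ δ : Type*}

theorem ncard_eq_mul_of_fiber [Finite α] [Finite β] (f : α → β) {s : Set α} {t : Set β} {n : ℕ}
    (hf : ∀ a ∈ s, f a ∈ t) (h : ∀ b ∈ t, {a | a ∈ s ∧ f a = b}.ncard = n) :
    s.ncard = n * t.ncard := by
  classical
  cases nonempty_fintype α
  cases nonempty_fintype β
  have h1 := Finset.card_eq_sum_card_fiberwise (f := f) (s := s.toFinset) (t := t.toFinset)
    (fun a ha => by simpa using hf a (by simpa using ha))
  rw [Set.ncard_eq_toFinset_card' s, Set.ncard_eq_toFinset_card' t, h1, mul_comm]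
  refine Finset.sum_const_nat fun b hb => ?_
  rw [← h b (by simpa using hb), Set.ncard_eq_toFinset_card']
  congr 1
  ext a
  simp

theorem ncard_rel_eq [Finite α] [Finite β] [Finite γ] [Finite δ] (e : α ≃ β) {R : α → γ → Prop}
    {R' : β → δ → Prop} (h : ∀ a, {y | R a y}.ncard = {y | R' (e a) y}.ncard) :
    {p : α × γ | R p.1 p.2}.ncard = {p : β × δ | R' p.1 p.2}.ncard := by
  rw [← Nat.card_coe_set_eq, ← Nat.card_coe_set_eq]
  refine Nat.card_congr ?_
  have e1 : {p : α × γ // R p.1 p.2} ≃ Σ a, {y // R a y} :=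
    Equiv.subtypeProdEquivSigmaSubtype R
  have e2 : {p : β × δ // R' p.1 p.2} ≃ Σ a, {y // R' a y} :=
    Equiv.subtypeProdEquivSigmaSubtype R'
  have e3 : ∀ a, Nonempty ({y // R a y} ≃ {y // R' (e a) y}) := fun a => by
    rw [← Finite.card_eq]
    exact h a
  exact e1.trans ((Equiv.sigmaCongr e fun a => (e3 a).some).trans e2.symm)

theorem ncard_setOf_eq_of_equiv (e : α ≃ β) {p : α → Prop} {q : β → Prop}
    (h : ∀ a, p a ↔ q (e a)) : {a | p a}.ncard = {b | q b}.ncard := by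
  rw [← Nat.card_coe_set_eq, ← Nat.card_coe_set_eq]
  exact Nat.card_congr (e.subtypeEquiv h)

end Counting

/-! ### Color multisets of vertex sets. -/

section VertexColors

variable {C A B : Type*} [Finite A] [Finite B]

/-- The multiset of the colors of the vertices in `S`. -/
noncomputable def vertexColors (c : A → A → C) (S : Set A) : Multiset C :=
  S.toFinite.toFinset.val.map fun v => c v v

variable {c : A → A → C} {c' : B → B → C}

theorem card_vertexColors (S : Set A) : (vertexColors c S).card = S.ncard := by
  rw [vertexColors, Multiset.card_map, Set.ncard_eq_toFinset_card S]
  rfl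

theorem exists_equiv_of_vertexColors_eq {S : Set A} {S' : Set B}
    (h : vertexColors c S = vertexColors c' S') :
    ∃ e : S ≃ S', ∀ x : S, c x x = c' (e x) (e x) := by
  obtain ⟨e, he⟩ := exists_equiv_of_map_val_eq _ _ _ _ h
  exact ⟨((Equiv.subtypeEquivRight (by simp)).symm.trans e).trans
    (Equiv.subtypeEquivRight (by simp)), fun x => he ⟨x, by simp⟩⟩

theorem vertexColors_eq_of_equiv {S : Set A} {S' : Set B} (e : A ≃ B)
    (hmem : ∀ w, w ∈ S ↔ e w ∈ S') (hc : ∀ w, c w w = c' (e w) (e w)) :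
    vertexColors c S = vertexColors c' S' := by
  have h : S'.toFinite.toFinset = S.toFinite.toFinset.map e.toEmbedding := by
    ext w
    obtain ⟨w, rfl⟩ := e.surjective w
    simp [hmem]
  rw [vertexColors, vertexColors, h, Finset.map_val, Multiset.map_map]
  exact Multiset.map_congr rfl fun w _ => hc w

end VertexColors

/-! ### Edge-biconnected components and the block cut-edge tree. -/

section EdgeComponents

variable {V : Type*} {G : SimpleGraph V}

/-- The graph without its cut edges. -/
def nonCutGraph (G : SimpleGraph V) : SimpleGraph V := G.deleteEdges {e | IsCutEdge G e}

theorem nonCutGraph_adj {a b : V} :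
    (nonCutGraph G).Adj a b ↔ G.Adj a b ∧ ¬ IsCutEdge G s(a, b) := SimpleGraph.deleteEdges_adj

theorem nonCutGraph_le : nonCutGraph G ≤ G := SimpleGraph.deleteEdges_le _

theorem nonCutGraph_le_deleteEdges {e : Sym2 V} (he : IsCutEdge G e) :
    nonCutGraph G ≤ G.deleteEdges {e} := by
  intro a b hab
  obtain ⟨h1, h2⟩ := nonCutGraph_adj.1 hab
  exact SimpleGraph.deleteEdges_adj.2 ⟨h1, fun hh => h2 (hh ▸ he)⟩

theorem IsCutEdge.not_reachable [Finite V] {a b : V} (h : IsCutEdge G s(a, b)) :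
    ¬ (G.deleteEdges {s(a, b)}).Reachable a b := (isCutEdge_iff_isBridge.1 h).2

theorem IsCutEdge.not_reachable_nonCutGraph [Finite V] {a b : V} (h : IsCutEdge G s(a, b)) :
    ¬ (nonCutGraph G).Reachable a b := fun hr =>
  h.not_reachable (hr.mono (nonCutGraph_le_deleteEdges h))

theorem reachable_induce_of_forall_mem {s : Set V} {a b : V} (ha : a ∈ s) (hb : b ∈ s)
    (hs : ∀ z, G.Reachable a z → z ∈ s) (h : G.Reachable a b) :
    (G.induce s).Reachable ⟨a, ha⟩ ⟨b, hb⟩ := by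
  classical
  obtain ⟨p⟩ := h
  exact (p.induce s fun z hz => hs z (p.takeUntil z hz).reachable).reachable

/-- A cut edge of `G` with both ends in `T` would be a cut edge of `G.induce T`. -/
theorem EdgeBiconnected.reachable_nonCutGraph [Finite V] {T : Set V}
    (h : EdgeBiconnected (G.induce T)) {a b : V} (ha : a ∈ T) (hb : b ∈ T) :
    (nonCutGraph G).Reachable a b := by
  refine (h.1.preconnected ⟨a, ha⟩ ⟨b, hb⟩).map
    (⟨Subtype.val, fun {x y} hxy => nonCutGraph_adj.2 ⟨hxy, fun hcut => ?_⟩⟩ :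
      G.induce T →g nonCutGraph G)
  refine h.2 s(x, y) (isCutEdge_iff_isBridge.2 ⟨hxy, fun hr => hcut.not_reachable ?_⟩)
  refine hr.map (⟨Subtype.val, fun {z w} hzw => ?_⟩ :
    (G.induce T).deleteEdges {s(x, y)} →g G.deleteEdges {s(x.1, y.1)})
  obtain ⟨h1, h2⟩ := SimpleGraph.deleteEdges_adj.1 hzw
  refine SimpleGraph.deleteEdges_adj.2 ⟨h1, fun hh => h2 ?_⟩
  rcases Sym2.eq_iff.1 hh with ⟨h3, h4⟩ | ⟨h3, h4⟩
  · exact Sym2.eq_iff.2 (Or.inl ⟨Subtype.ext h3, Subtype.ext h4⟩)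
  · exact Sym2.eq_iff.2 (Or.inr ⟨Subtype.ext h3, Subtype.ext h4⟩)

/-- An edge that is not a cut edge lies on a cycle, which has no cut edge. -/
theorem reachable_nonCutGraph_deleteEdges [Finite V] {x y : V} (hxy : G.Adj x y)
    (h : ¬ IsCutEdge G s(x, y)) : ((nonCutGraph G).deleteEdges {s(x, y)}).Reachable x y := by
  have hr : (G.deleteEdges {s(x, y)}).Reachable x y := by
    by_contra hr
    exact h (isCutEdge_iff_isBridge.2 ⟨hxy, hr⟩)
  obtain ⟨p, hp⟩ := hr.exists_isPath
  let q := p.mapLe (SimpleGraph.deleteEdges_le {s(x, y)})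
  have hq : q.edges = p.edges := by simp [q]
  have hpe : ∀ e ∈ p.edges, e ∈ G.edgeSet ∧ e ≠ s(x, y) := fun e he => by
    have := p.edges_subset_edgeSet he
    rw [SimpleGraph.edgeSet_deleteEdges] at this
    exact this
  have hcyc : (SimpleGraph.Walk.cons hxy.symm q).IsCycle := by
    rw [SimpleGraph.Walk.cons_isCycle_iff, hq]
    exact ⟨hp.mapLe _, fun he => (hpe _ he).2 Sym2.eq_swap⟩
  refine (p.transfer _ fun e he => ?_).reachable
  obtain ⟨h1, h2⟩ := hpe e he
  rw [SimpleGraph.edgeSet_deleteEdges, nonCutGraph, SimpleGraph.edgeSet_deleteEdges]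
  refine ⟨⟨h1, fun hcut => ?_⟩, h2⟩
  induction e using Sym2.ind with
  | _ a b =>
    refine (SimpleGraph.isBridge_iff_forall_cycle_notMem h1).1
      (isCutEdge_iff_isBridge.1 hcut).2 _ hcyc ?_
    rw [SimpleGraph.Walk.edges_cons, hq]
    exact List.mem_cons_of_mem _ he

/-- An edge of `G` inside the component is not a cut edge, so it lies on a cycle of non-cut edges,
which stays in the component. -/
theorem edgeBiconnected_induce_component [Finite V] (v : V) :
    EdgeBiconnected (G.induce {z | (nonCutGraph G).Reachable v z}) := by
  constructor
  · refine (SimpleGraph.connected_iff_exists_forall_reachable _).2 ⟨⟨v, .rfl⟩, fun ⟨z, hz⟩ => ?_⟩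
    refine (reachable_induce_of_forall_mem .rfl hz (fun _ h => h) hz).mono ?_
    exact fun a b hab => show G.Adj a.1 b.1 from nonCutGraph_le hab
  · intro e
    induction e using Sym2.ind with
    | _ x y =>
      intro hcut
      have hxy : G.Adj x.1 y.1 := hcut.adj
      have hnc : ¬ IsCutEdge G s(x.1, y.1) := fun hc =>
        hc.not_reachable_nonCutGraph (x.2.symm.trans y.2)
      refine hcut.not_reachable ((reachable_induce_of_forall_mem x.2 y.2 (fun z hz => ?_)
        (reachable_nonCutGraph_deleteEdges hxy hnc)).mono ?_)
      · exact x.2.trans (hz.mono (SimpleGraph.deleteEdges_le _))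
      · intro a b hab
        obtain ⟨h1, h2⟩ := SimpleGraph.deleteEdges_adj.1 hab
        refine SimpleGraph.deleteEdges_adj.2
          ⟨show G.Adj a.1 b.1 from nonCutGraph_le h1, fun hh => h2 ?_⟩
        exact congrArg (Sym2.map Subtype.val) hh

theorem mem_edgeBCC_iff [Finite V] {S : Set V} :
    S ∈ edgeBCC G ↔ ∃ v, S = {z | (nonCutGraph G).Reachable v z} := by
  constructor
  · intro hS
    replace hS : Maximal (fun T : Set V => EdgeBiconnected (G.induce T)) S := hS
    obtain ⟨v, hv⟩ := hS.prop.1.nonempty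
    exact ⟨v, hS.eq_of_le (edgeBiconnected_induce_component v)
      fun z hz => hS.prop.reachable_nonCutGraph hv hz⟩
  · rintro ⟨v, rfl⟩
    exact ⟨edgeBiconnected_induce_component v,
      fun T hT hle z hz => hT.reachable_nonCutGraph (hle .rfl) hz⟩

/-- The edge-biconnected component of a vertex. -/
def edgeComponent [Finite V] (G : SimpleGraph V) (v : V) : edgeBCC G :=
  ⟨{z | (nonCutGraph G).Reachable v z}, mem_edgeBCC_iff.2 ⟨v, rfl⟩⟩

theorem edgeComponent_eq_iff [Finite V] {a b : V} :
    edgeComponent G a = edgeComponent G b ↔ (nonCutGraph G).Reachable a b := by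
  constructor
  · intro h
    have : b ∈ (edgeComponent G a).1 := h ▸ SimpleGraph.Reachable.rfl
    exact this
  · intro h
    exact Subtype.ext (Set.ext fun z => ⟨h.symm.trans, h.trans⟩)

theorem mem_edgeBCC_iff_edgeComponent_eq [Finite V] {S : edgeBCC G} {v : V} :
    v ∈ S.1 ↔ edgeComponent G v = S := by
  obtain ⟨S, hS⟩ := S
  obtain ⟨w, rfl⟩ := mem_edgeBCC_iff.1 hS
  change _ ↔ edgeComponent G v = edgeComponent G w
  rw [edgeComponent_eq_iff]
  exact ⟨fun h => h.symm, fun h => h.symm⟩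

theorem bceTree_adj_iff [Finite V] {S₁ S₂ : edgeBCC G} : (BCETree G).Adj S₁ S₂ ↔
    ∃ u v, edgeComponent G u = S₁ ∧ edgeComponent G v = S₂ ∧ IsCutEdge G s(u, v) := by
  constructor
  · rintro ⟨hne, u, hu, v, hv, huv⟩
    rw [mem_edgeBCC_iff_edgeComponent_eq] at hu hv
    refine ⟨u, v, hu, hv, ?_⟩
    by_contra hcon
    exact hne (hu ▸ hv ▸ edgeComponent_eq_iff.2 (nonCutGraph_adj.2 ⟨huv, hcon⟩).reachable)
  · rintro ⟨u, v, rfl, rfl, huv⟩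
    exact ⟨fun hh => huv.not_reachable_nonCutGraph (edgeComponent_eq_iff.1 hh),
      u, .rfl, v, .rfl, huv.adj⟩

/-- A second cut edge between the same components would bypass the first. Hence neighbors in the
tree can be counted as cut edges. -/
theorem IsCutEdge.eq_of_edgeComponent_eq [Finite V] {u v u' v' : V} (h : IsCutEdge G s(u, v))
    (h' : IsCutEdge G s(u', v')) (hu : edgeComponent G u = edgeComponent G u')
    (hv : edgeComponent G v = edgeComponent G v') : u = u' ∧ v = v' := by
  rw [edgeComponent_eq_iff] at hu hv
  by_cases heq : s(u', v') = s(u, v)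
  · rcases Sym2.eq_iff.1 heq with ⟨rfl, rfl⟩ | ⟨rfl, rfl⟩
    · exact ⟨rfl, rfl⟩
    · exact (h.not_reachable_nonCutGraph hu).elim
  · have hle := nonCutGraph_le_deleteEdges h
    have hadj : (G.deleteEdges {s(u, v)}).Adj u' v' :=
      SimpleGraph.deleteEdges_adj.2 ⟨h'.adj, heq⟩
    exact (h.not_reachable (((hu.mono hle).trans hadj.reachable).trans (hv.symm.mono hle))).elim

theorem isAcyclic_bceTree [Finite V] : (BCETree G).IsAcyclic := by
  rw [SimpleGraph.isAcyclic_iff_forall_adj_isBridge]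
  intro S₁ S₂ h
  obtain ⟨u, v, rfl, rfl, huv⟩ := bceTree_adj_iff.1 h
  rw [SimpleGraph.isBridge_iff]
  rintro ⟨p⟩
  have hle := nonCutGraph_le_deleteEdges huv
  -- A tree walk avoiding the edge lifts to `G`: non-cut edges inside components, and cut edges
  -- other than `{u, v}` between them.
  have key : ∀ S S' (q : ((BCETree G).deleteEdges
      {s(edgeComponent G u, edgeComponent G v)}).Walk S S'), ∀ a b, edgeComponent G a = S →
      edgeComponent G b = S' → (G.deleteEdges {s(u, v)}).Reachable a b := by
    intro S S' q
    induction q with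
    | nil => exact fun a b ha hb => (edgeComponent_eq_iff.1 (ha.trans hb.symm)).mono hle
    | cons hadj q ih =>
      intro a b ha hb
      obtain ⟨h1, h2⟩ := SimpleGraph.deleteEdges_adj.1 hadj
      obtain ⟨x, y, rfl, rfl, hxy⟩ := bceTree_adj_iff.1 h1
      refine ((edgeComponent_eq_iff.1 ha).mono hle).trans
        (SimpleGraph.Reachable.trans (SimpleGraph.Adj.reachable ?_) (ih y b rfl hb))
      exact SimpleGraph.deleteEdges_adj.2 ⟨hxy.adj, fun hh => h2
        (by simpa using congrArg (Sym2.map (edgeComponent G)) hh)⟩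
  exact huv.not_reachable (key _ _ p u v rfl rfl)

end EdgeComponents

/-! ### Isomorphism of block cut-edge trees. -/

section EdgeComponentColors

variable {C A B : Type*} [Finite A] [Finite B] {c : A → A → C} {c' : B → B → C}
  {G : SimpleGraph A} {H : SimpleGraph B}

theorem AdjCompatible.nonCutGraph (h : CoherentPair c c') (hadj : AdjCompatible c c' G H) :
    AdjCompatible c c' (nonCutGraph G) (nonCutGraph H) := fun hc => by
  rw [nonCutGraph_adj, nonCutGraph_adj, hadj hc, isCutEdge_iff_of_color_eq h hadj hc]

theorem vertexColors_edgeComponent_eq (h : CoherentPair c c') (hadj : AdjCompatible c c' G H)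
    {v : A} {v' : B} (hc : c v v = c' v' v') :
    vertexColors c (edgeComponent G v).1 = vertexColors c' (edgeComponent H v').1 := by
  obtain ⟨e, he⟩ := h.exists_equiv hc
  exact vertexColors_eq_of_equiv e
    (fun w => reachable_iff_of_color_eq h (hadj.nonCutGraph h) (he w).2)
    fun w => h.diag_right (he w).2

/-- Color-preserving bijections match vertices, not components; a component of color `k` accounts
for `k.card` vertices. -/
theorem card_mul_ncard_edgeBCC (k : Multiset C) :
    {v | vertexColors c (edgeComponent G v).1 = k}.ncard =
      k.card * {S : edgeBCC G | vertexColors c S.1 = k}.ncard := by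
  refine ncard_eq_mul_of_fiber (edgeComponent G) (fun _ h => h) fun S hS => ?_
  rw [← show vertexColors c S.1 = k from hS, card_vertexColors]
  congr 1
  ext v
  rw [mem_edgeBCC_iff_edgeComponent_eq]
  refine ⟨And.right, fun hv => ⟨?_, hv⟩⟩
  change vertexColors c (edgeComponent G v).1 = _
  rw [hv]

theorem vertexColors_edgeBCC_ne_zero (S : edgeBCC G) : vertexColors c S.1 ≠ 0 := by
  intro h
  have h1 := card_vertexColors (c := c) S.1
  rw [h, Multiset.card_zero, eq_comm, Set.ncard_eq_zero] at h1
  obtain ⟨v, hv⟩ := mem_edgeBCC_iff.1 S.2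
  have : v ∈ S.1 := hv ▸ SimpleGraph.Reachable.rfl
  simp [h1] at this

theorem ncard_bceTree_adj (S : edgeBCC G) (k : Multiset C) :
    {S₂ | (BCETree G).Adj S S₂ ∧ vertexColors c S₂.1 = k}.ncard =
      {p : S.1 × A | IsCutEdge G s(p.1.1, p.2) ∧
        vertexColors c (edgeComponent G p.2).1 = k}.ncard := by
  symm
  refine Set.ncard_congr (fun p _ => edgeComponent G p.2) ?_ ?_ ?_
  · rintro ⟨⟨u, hu⟩, v⟩ ⟨h1, h2⟩
    exact ⟨bceTree_adj_iff.2 ⟨u, v, mem_edgeBCC_iff_edgeComponent_eq.1 hu, rfl, h1⟩, h2⟩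
  · rintro ⟨⟨u, hu⟩, v⟩ ⟨⟨u', hu'⟩, v'⟩ ⟨h1, -⟩ ⟨h2, -⟩ heq
    rw [mem_edgeBCC_iff_edgeComponent_eq] at hu hu'
    obtain ⟨rfl, rfl⟩ := h1.eq_of_edgeComponent_eq h2 (hu.trans hu'.symm) heq
    rfl
  · rintro S₂ ⟨h1, h2⟩
    obtain ⟨u, v, hu, rfl, huv⟩ := bceTree_adj_iff.1 h1
    exact ⟨⟨⟨u, mem_edgeBCC_iff_edgeComponent_eq.2 hu⟩, v⟩, ⟨huv, h2⟩, rfl⟩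

theorem nonempty_bceTree_iso (h : CoherentPair c c') (hadj : AdjCompatible c c' G H) (e : A ≃ B)
    (he : ∀ v, c v v = c' (e v) (e v)) : Nonempty (BCETree G ≃g BCETree H) := by
  refine nonempty_iso_of_isAcyclic_of_equitable isAcyclic_bceTree isAcyclic_bceTree
    (p := fun S => vertexColors c S.1) (q := fun S => vertexColors c' S.1) (fun k => ?_)
    fun S S' hS k => ?_
  -- The factor `k.card` cannot be cancelled at `k = 0`, but no component is empty.
  · by_cases hk : k = 0
    · subst hk
      simp [vertexColors_edgeBCC_ne_zero]
    · have h1 : {v | vertexColors c (edgeComponent G v).1 = k}.ncard =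
          {v | vertexColors c' (edgeComponent H v).1 = k}.ncard :=
        ncard_setOf_eq_of_equiv e fun v => by rw [vertexColors_edgeComponent_eq h hadj (he v)]
      rw [card_mul_ncard_edgeBCC, card_mul_ncard_edgeBCC] at h1
      exact Nat.eq_of_mul_eq_mul_left (Multiset.card_pos.2 hk) h1
  · rw [ncard_bceTree_adj, ncard_bceTree_adj]
    -- Vertices of the two components matched by color have equally many cut edges to components of
    -- color `k`.
    obtain ⟨f, hf⟩ := exists_equiv_of_vertexColors_eq hS
    refine ncard_rel_eq f (R := fun u v => IsCutEdge G s(u.1, v) ∧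
        vertexColors c (edgeComponent G v).1 = k) (R' := fun u v => IsCutEdge H s(u.1, v) ∧
        vertexColors c' (edgeComponent H v).1 = k) fun u => ?_
    obtain ⟨g, hg⟩ := h.exists_equiv (hf u)
    exact ncard_setOf_eq_of_equiv g fun w => by
      rw [isCutEdge_iff_of_color_eq h hadj (hg w).2,
        vertexColors_edgeComponent_eq h hadj (h.diag_right (hg w).2)]

end EdgeComponentColors

/-! ### Vertex-biconnected components and the block cut-vertex tree. -/

section Blocks

variable {V : Type*} {G : SimpleGraph V}

/-- No vertex separates `v` from `w`. -/
def Inseparable (G : SimpleGraph V) (v w : V) : Prop :=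
  G.Reachable v w ∧ ∀ u, u ≠ v → u ≠ w → (G.deleteIncidenceSet u).Reachable v w

theorem Inseparable.refl (v : V) : Inseparable G v v := ⟨.rfl, fun _ _ _ => .rfl⟩

theorem Inseparable.symm {v w : V} (h : Inseparable G v w) : Inseparable G w v :=
  ⟨h.1.symm, fun u h1 h2 => (h.2 u h2 h1).symm⟩

/-- A vertex `u` differs from `v` or `w`, so `a` and `b` are joined through that one. This replaces
transitivity, which fails at cut vertices. -/
theorem Inseparable.of_common {v w a b : V} (hvw : v ≠ w) (hva : Inseparable G v a)
    (hvb : Inseparable G v b) (hwa : Inseparable G w a) (hwb : Inseparable G w b) :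
    Inseparable G a b := by
  refine ⟨hva.1.symm.trans hvb.1, fun u hua hub => ?_⟩
  by_cases huv : u = v
  · have huw : u ≠ w := huv ▸ hvw
    exact (hwa.2 u huw hua).symm.trans (hwb.2 u huw hub)
  · exact (hva.2 u huv hua).symm.trans (hvb.2 u huv hub)

theorem Inseparable.of_reachable {v a b : V} (hva : Inseparable G v a) (hvb : Inseparable G v b)
    (h : (G.deleteIncidenceSet v).Reachable a b) : Inseparable G a b := by
  refine ⟨hva.1.symm.trans hvb.1, fun u hua hub => ?_⟩
  by_cases huv : u = v
  · exact huv ▸ h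
  · exact (hva.2 u huv hua).symm.trans (hvb.2 u huv hub)

/-- The vertices of `S` are pairwise inseparable. -/
def InseparableSet (G : SimpleGraph V) (S : Set V) : Prop :=
  ∀ a ∈ S, ∀ b ∈ S, Inseparable G a b

theorem InseparableSet.insert {S : Set V} (h : InseparableSet G S) {x : V}
    (hx : ∀ a ∈ S, Inseparable G x a) : InseparableSet G (insert x S) := by
  rintro a (rfl | ha) b (rfl | hb)
  · exact .refl _
  · exact hx b hb
  · exact (hx a ha).symm
  · exact h a ha b hb

theorem VertexBiconnected.inseparableSet [Finite V] {T : Set V}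
    (h : VertexBiconnected (G.induce T)) : InseparableSet G T := by
  intro a ha b hb
  have hr := h.1.preconnected ⟨a, ha⟩ ⟨b, hb⟩
  refine ⟨hr.map (SimpleGraph.Embedding.induce T).toHom, fun u hua hub => ?_⟩
  by_cases hu : u ∈ T
  · have hcut := h.2 ⟨u, hu⟩
    rw [isCutVertex_iff] at hcut
    push Not at hcut
    refine (hcut ⟨a, ha⟩ ⟨b, hb⟩ (fun hh => hua (congrArg Subtype.val hh).symm)
      (fun hh => hub (congrArg Subtype.val hh).symm) hr).map
      (⟨Subtype.val, fun {x y} hxy => ?_⟩ :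
        (G.induce T).deleteIncidenceSet ⟨u, hu⟩ →g G.deleteIncidenceSet u)
    obtain ⟨h1, h2, h3⟩ := SimpleGraph.deleteIncidenceSet_adj.1 hxy
    exact SimpleGraph.deleteIncidenceSet_adj.2
      ⟨h1, fun hh => h2 (Subtype.ext hh), fun hh => h3 (Subtype.ext hh)⟩
  · refine hr.map (⟨Subtype.val, fun {x y} hxy => ?_⟩ : G.induce T →g G.deleteIncidenceSet u)
    exact SimpleGraph.deleteIncidenceSet_adj.2
      ⟨hxy, fun hh => hu (hh ▸ x.2), fun hh => hu (hh ▸ y.2)⟩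

/-- A path between two vertices of a block stays in the block. -/
theorem mem_of_mem_support_of_maximal {S : Set V} (hS : Maximal (InseparableSet G) S) {a b x : V}
    (ha : a ∈ S) (hb : b ∈ S) (p : G.Walk a b) (hp : p.IsPath) (hx : x ∈ p.support) : x ∈ S := by
  classical
  refine hS.2 (hS.1.insert fun s hs => ⟨?_, fun u hux hus => ?_⟩) (Set.subset_insert x S)
    (Set.mem_insert x S)
  · exact (p.takeUntil x hx).reachable.symm.trans (hS.1 a ha s hs).1
  -- As `u ≠ x`, one half of the path at `x` avoids `u`. It joins `x` to an end in `S`, which `u`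
  -- does not separate from `s`.
  · by_cases hu : u ∈ (p.takeUntil x hx).support
    · have hu' : u ∉ (p.dropUntil x hx).support := by
        intro hu'
        have hnd := hp.support_nodup
        rw [← p.take_spec hx, SimpleGraph.Walk.support_append] at hnd
        rw [← SimpleGraph.Walk.cons_tail_support, List.mem_cons] at hu'
        exact (List.disjoint_of_nodup_append hnd) hu (hu'.resolve_left hux)
      have hub : u ≠ b := by
        rintro rfl
        exact hu' (SimpleGraph.Walk.end_mem_support _)
      exact (reachable_deleteIncidenceSet_of_not_mem_support _ hu').trans
        ((hS.1 b hb s hs).2 u hub hus)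
    · have hua : u ≠ a := by
        rintro rfl
        exact hu (SimpleGraph.Walk.start_mem_support _)
      exact (reachable_deleteIncidenceSet_of_not_mem_support _ hu).symm.trans
        ((hS.1 a ha s hs).2 u hua hus)

theorem vertexBiconnected_induce_of_maximal [Finite V] {S : Set V} (hne : S.Nonempty)
    (hS : Maximal (InseparableSet G) S) : VertexBiconnected (G.induce S) := by
  constructor
  · have : Nonempty S := hne.to_subtype
    refine ⟨fun ⟨a, ha⟩ ⟨b, hb⟩ => ?_⟩
    obtain ⟨p, hp⟩ := (hS.1 a ha b hb).1.exists_isPath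
    exact (p.induce S fun x hx => mem_of_mem_support_of_maximal hS ha hb p hp hx).reachable
  · rintro ⟨u, hu⟩ hcut
    obtain ⟨⟨a, ha⟩, ⟨b, hb⟩, hau, hbu, -, hsep⟩ := isCutVertex_iff.1 hcut
    obtain ⟨p, hp⟩ := ((hS.1 a ha b hb).2 u (fun hh => hau (Subtype.ext hh.symm))
      fun hh => hbu (Subtype.ext hh.symm)).exists_isPath
    refine hsep ((p.induce S fun x hx => mem_of_mem_support_of_maximal hS ha hb
      (p.mapLe (G.deleteIncidenceSet_le u)) (hp.mapLe _) (by simpa using hx)).reachable.mono ?_)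
    intro x y hxy
    obtain ⟨h1, h2, h3⟩ := SimpleGraph.deleteIncidenceSet_adj.1 hxy
    exact SimpleGraph.deleteIncidenceSet_adj.2
      ⟨h1, fun hh => h2 (congrArg Subtype.val hh), fun hh => h3 (congrArg Subtype.val hh)⟩

/-- Biconnected sets are inseparable, and nonempty maximal inseparable sets are biconnected because
they contain all paths between their vertices. -/
theorem mem_vertexBCC_iff [Finite V] {S : Set V} :
    S ∈ vertexBCC G ↔ S.Nonempty ∧ Maximal (InseparableSet G) S := by
  constructor
  · intro hS
    replace hS : Maximal (fun T : Set V => VertexBiconnected (G.induce T)) S := hS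
    have hne : S.Nonempty := Set.nonempty_coe_sort.1 hS.prop.1.nonempty
    refine ⟨hne, hS.prop.inseparableSet, fun T hT hle => ?_⟩
    obtain ⟨M, hTM, hM⟩ := (Set.toFinite {T : Set V | InseparableSet G T}).exists_le_maximal hT
    exact hTM.trans (hS.2 (vertexBiconnected_induce_of_maximal (hne.mono (hle.trans hTM)) hM)
      (hle.trans hTM))
  · rintro ⟨hne, hS⟩
    exact ⟨vertexBiconnected_induce_of_maximal hne hS,
      fun T hT hle => hS.2 (VertexBiconnected.inseparableSet hT) hle⟩

/-- The vertices that are inseparable from both `v` and `w`. -/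
def block (G : SimpleGraph V) (v w : V) : Set V := {z | Inseparable G v z ∧ Inseparable G w z}

/-- `v` and `w` are inseparable, and distinct unless `v` is isolated: the condition under which
`block G v w` is the block of `v` and `w`. -/
def SpansBlock (G : SimpleGraph V) (v w : V) : Prop :=
  Inseparable G v w ∧ (w = v → ∀ x, Inseparable G v x → x = v)

theorem SpansBlock.of_ne {v w : V} (h : Inseparable G v w) (hne : w ≠ v) : SpansBlock G v w :=
  ⟨h, fun hh => (hne hh).elim⟩

theorem SpansBlock.mem_left {v w : V} (h : SpansBlock G v w) : v ∈ block G v w :=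
  ⟨.refl v, h.1.symm⟩

theorem SpansBlock.mem_right {v w : V} (h : SpansBlock G v w) : w ∈ block G v w :=
  ⟨h.1, .refl w⟩

theorem SpansBlock.block_mem [Finite V] {v w : V} (h : SpansBlock G v w) :
    block G v w ∈ vertexBCC G := by
  refine mem_vertexBCC_iff.2 ⟨⟨v, h.mem_left⟩, fun a ha b hb => ?_, fun T hT hle z hz =>
    ⟨hT v (hle h.mem_left) z hz, hT w (hle h.mem_right) z hz⟩⟩
  by_cases hwv : w = v
  · rw [h.2 hwv a ha.1, h.2 hwv b hb.1]
    exact .refl v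
  · exact .of_common (Ne.symm hwv) ha.1 hb.1 ha.2 hb.2

theorem inseparable_of_mem_vertexBCC [Finite V] {S : Set V} (hS : S ∈ vertexBCC G) {v w : V}
    (hv : v ∈ S) (hw : w ∈ S) : Inseparable G v w := (mem_vertexBCC_iff.1 hS).2.1 v hv w hw

theorem eq_block_of_mem [Finite V] {S : Set V} (hS : S ∈ vertexBCC G) {v w : V} (hv : v ∈ S)
    (hw : w ∈ S) (h : SpansBlock G v w) : S = block G v w := by
  refine (mem_vertexBCC_iff.1 hS).2.eq_of_le (mem_vertexBCC_iff.1 h.block_mem).2.1 fun z hz => ?_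
  exact ⟨inseparable_of_mem_vertexBCC hS hv hz, inseparable_of_mem_vertexBCC hS hw hz⟩

theorem spansBlock_self_of_singleton_mem [Finite V] {v : V} (h : {v} ∈ vertexBCC G) :
    SpansBlock G v v := by
  refine ⟨.refl v, fun _ x hx => ?_⟩
  have hcl : InseparableSet G (insert x {v}) :=
    (mem_vertexBCC_iff.1 h).2.1.insert fun a ha => by
      rw [Set.mem_singleton_iff.1 ha]
      exact hx.symm
  simpa using (mem_vertexBCC_iff.1 h).2.2 hcl (Set.subset_insert x {v}) (Set.mem_insert x {v})

/-- The vertices that span a given block together with `v`: all others, if there are others. -/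
theorem ncard_spansBlock_eq [Finite V] {S : Set V} (hS : S ∈ vertexBCC G) {v : V} (hv : v ∈ S) :
    {w | SpansBlock G v w ∧ block G v w = S}.ncard = max (S.ncard - 1) 1 := by
  -- A one-vertex block is spanned only by `v` with itself, hence the `max` with 1.
  by_cases hSv : S = {v}
  · subst hSv
    have h := spansBlock_self_of_singleton_mem hS
    have : {w | SpansBlock G v w ∧ block G v w = {v}} = {v} := by
      ext w
      constructor
      · rintro ⟨h1, h2⟩
        exact h2 ▸ h1.mem_right
      · rintro rfl
        exact ⟨h, (eq_block_of_mem hS rfl rfl h).symm⟩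
    simp [this]
  · have : {w | SpansBlock G v w ∧ block G v w = S} = S \ {v} := by
      ext w
      constructor
      · rintro ⟨h1, h2⟩
        refine ⟨h2 ▸ h1.mem_right, fun hwv => hSv ?_⟩
        refine Set.Subset.antisymm (fun x hx => ?_) (Set.singleton_subset_iff.2 hv)
        exact h1.2 hwv x (inseparable_of_mem_vertexBCC hS hv hx)
      · rintro ⟨h1, h2⟩
        have h3 := SpansBlock.of_ne (inseparable_of_mem_vertexBCC hS hv h1) h2
        exact ⟨h3, (eq_block_of_mem hS hv h1 h3).symm⟩
    rw [this, Set.ncard_sdiff_singleton_of_mem hv]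
    have h1 : 1 < S.ncard := by
      by_contra hle
      exact hSv (Set.eq_singleton_iff_unique_mem.2 ⟨hv, fun x hx =>
        (Set.ncard_le_one).1 (not_lt.1 hle) x hx v hv⟩)
    omega

theorem bcvTree_adj_inl_inr {S : vertexBCC G} {v : {v // IsCutVertex G v}} :
    (BCVTree G).Adj (Sum.inl S) (Sum.inr v) ↔ v.1 ∈ S.1 := by
  simp [BCVTree]

theorem bcvTree_adj_inr_inl {S : vertexBCC G} {v : {v // IsCutVertex G v}} :
    (BCVTree G).Adj (Sum.inr v) (Sum.inl S) ↔ v.1 ∈ S.1 := by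
  simp [BCVTree]

theorem not_bcvTree_adj_inl_inl {S S' : vertexBCC G} :
    ¬ (BCVTree G).Adj (Sum.inl S) (Sum.inl S') := by
  simp [BCVTree]

theorem not_bcvTree_adj_inr_inr {v v' : {v // IsCutVertex G v}} :
    ¬ (BCVTree G).Adj (Sum.inr v) (Sum.inr v') := by
  simp [BCVTree]

/-- The nodes on the side of the block `S` when the edge between `S` and `v` is removed, as
described by reachability without `v`. -/
def BlockSide (G : SimpleGraph V) (S : vertexBCC G) (v : V) :
    vertexBCC G ⊕ {v // IsCutVertex G v} → Prop
  | Sum.inl S' => S' = S ∨ (v ∉ S'.1 ∧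
      ∀ z ∈ S'.1, ∃ w ∈ S.1, w ≠ v ∧ (G.deleteIncidenceSet v).Reachable w z)
  | Sum.inr x => x.1 ≠ v ∧ ∃ w ∈ S.1, w ≠ v ∧ (G.deleteIncidenceSet v).Reachable w x.1

theorem BlockSide.of_adj [Finite V] {S : vertexBCC G} {v : {v // IsCutVertex G v}} (hv : v.1 ∈ S.1)
    {x y : vertexBCC G ⊕ {v // IsCutVertex G v}} (hx : BlockSide G S v x)
    (hxy : ((BCVTree G).deleteEdges {s(Sum.inl S, Sum.inr v)}).Adj x y) : BlockSide G S v y := by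
  obtain ⟨h1, h2⟩ := SimpleGraph.deleteEdges_adj.1 hxy
  rcases x with S' | x <;> rcases y with S'' | y
  · exact (not_bcvTree_adj_inl_inl h1).elim
  · rw [bcvTree_adj_inl_inr] at h1
    rcases hx with rfl | ⟨h3, h4⟩
    · have hyv : y.1 ≠ v.1 := fun hh => h2 (by rw [Subtype.ext hh]; rfl)
      exact ⟨hyv, y.1, h1, hyv, .rfl⟩
    · exact ⟨fun hh => h3 (hh ▸ h1), h4 _ h1⟩
  · rw [bcvTree_adj_inr_inl] at h1
    obtain ⟨hxv, w, hw, hwv, hwx⟩ := hx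
    by_cases hvS : v.1 ∈ S''.1
    -- `v` does not separate `w` from `x`, so `x` lies in `S` too. Two blocks sharing `v` and `x`
    -- coincide.
    · left
      have hvx := inseparable_of_mem_vertexBCC S''.2 hvS h1
      have hvw := inseparable_of_mem_vertexBCC S.2 hv hw
      have hwx' : Inseparable G w x := hvw.of_reachable hvx hwx
      have h3 := SpansBlock.of_ne hvx hxv
      have h4 := SpansBlock.of_ne hvw hwv
      have hxS : x.1 ∈ S.1 := by
        rw [eq_block_of_mem S.2 hv hw h4]
        exact ⟨hvx, hwx'⟩
      exact Subtype.ext ((eq_block_of_mem S''.2 hvS h1 h3).trans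
        (eq_block_of_mem S.2 hv hxS h3).symm)
    · exact Or.inr ⟨hvS, fun z hz => ⟨w, hw, hwv, hwx.trans
        ((inseparable_of_mem_vertexBCC S''.2 h1 hz).2 v (Ne.symm hxv) fun hh => hvS (hh ▸ hz))⟩⟩
  · exact (not_bcvTree_adj_inr_inr h1).elim

theorem isAcyclic_bcvTree [Finite V] : (BCVTree G).IsAcyclic := by
  have key : ∀ (S : vertexBCC G) (v : {v // IsCutVertex G v}), v.1 ∈ S.1 →
      (BCVTree G).IsBridge s(Sum.inl S, Sum.inr v) := by
    intro S v hv
    rw [SimpleGraph.isBridge_iff]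
    intro hr
    -- The side of `S` is closed under adjacency without the edge, but excludes `v`.
    have : BlockSide G S v (Sum.inr v) := mem_of_reachable_of_forall_adj
      (s := {x | BlockSide G S v x}) (fun x hx y hxy => hx.of_adj hv hxy) (Or.inl rfl) hr
    exact this.1 rfl
  rw [SimpleGraph.isAcyclic_iff_forall_adj_isBridge]
  rintro (S | v) (S' | v') h
  · exact (not_bcvTree_adj_inl_inl h).elim
  · exact key _ _ (bcvTree_adj_inl_inr.1 h)
  · exact Sym2.eq_swap ▸ key _ _ (bcvTree_adj_inr_inl.1 h)
  · exact (not_bcvTree_adj_inr_inr h).elim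

end Blocks

/-! ### Isomorphism of block cut-vertex trees. -/

section BlockColors

variable {C A B : Type*} [Finite A] [Finite B] {c : A → A → C} {c' : B → B → C}
  {G : SimpleGraph A} {H : SimpleGraph B}

theorem inseparable_iff_of_color_eq (h : CoherentPair c c') (hadj : AdjCompatible c c' G H)
    {v w : A} {v' w' : B} (hc : c v w = c' v' w') :
    Inseparable G v w ↔ Inseparable H v' w' := by
  obtain ⟨e, he⟩ := h.exists_equiv hc
  refine and_congr (reachable_iff_of_color_eq h hadj hc) (e.forall_congr fun u => ?_)
  refine imp_congr (not_congr (h.diag (h.swap (he u).2)))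
    (imp_congr_ctx (not_congr (h.diag (he u).1)) fun hne => ?_)
  exact reachable_deleteIncidenceSet_iff_of_color_eq h hadj (he u).2 (he u).1 hc
    (Ne.symm (mt (h.diag (he u).1).1 hne))

theorem vertexColors_block_eq (h : CoherentPair c c') (hadj : AdjCompatible c c' G H)
    {v w : A} {v' w' : B} (hc : c v w = c' v' w') :
    vertexColors c (block G v w) = vertexColors c' (block H v' w') := by
  obtain ⟨e, he⟩ := h.exists_equiv hc
  exact vertexColors_eq_of_equiv e
    (fun z => and_congr (inseparable_iff_of_color_eq h hadj (he z).2)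
      (inseparable_iff_of_color_eq h hadj (h.swap (he z).1)))
    fun z => h.diag_right (he z).2

theorem spansBlock_iff_of_color_eq (h : CoherentPair c c') (hadj : AdjCompatible c c' G H)
    {v w : A} {v' w' : B} (hc : c v w = c' v' w') : SpansBlock G v w ↔ SpansBlock H v' w' := by
  obtain ⟨e, he⟩ := h.exists_equiv hc
  refine and_congr (inseparable_iff_of_color_eq h hadj hc)
    (imp_congr (h.diag (h.swap hc)) (e.forall_congr fun x => ?_))
  exact imp_congr (inseparable_iff_of_color_eq h hadj (he x).2) (h.diag (h.swap (he x).2))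

/-- A spanning pair determines its block, so blocks through `v` can be counted by partners `w`; the
number of partners per block depends only on `m.card`. -/
theorem ncard_spansBlock_eq_mul (v : A) (m : Multiset C) :
    {w | SpansBlock G v w ∧ vertexColors c (block G v w) = m}.ncard =
      max (m.card - 1) 1 * {S | v ∈ S ∧ S ∈ vertexBCC G ∧ vertexColors c S = m}.ncard := by
  refine ncard_eq_mul_of_fiber (block G v) (fun w hw => ⟨hw.1.mem_left, hw.1.block_mem, hw.2⟩) ?_
  rintro S ⟨hv, hS, rfl⟩
  rw [card_vertexColors, ← ncard_spansBlock_eq hS hv]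
  congr 1
  ext w
  constructor
  · rintro ⟨⟨h1, -⟩, h2⟩
    exact ⟨h1, h2⟩
  · rintro ⟨h1, h2⟩
    exact ⟨⟨h1, by rw [h2]⟩, h2⟩

/-- The number of blocks of each color through a vertex is determined by the color of the
vertex. -/
theorem ncard_vertexBCC_through_eq (h : CoherentPair c c') (hadj : AdjCompatible c c' G H)
    {v : A} {v' : B} (hc : c v v = c' v' v') (m : Multiset C) :
    {S | v ∈ S ∧ S ∈ vertexBCC G ∧ vertexColors c S = m}.ncard =
      {S | v' ∈ S ∧ S ∈ vertexBCC H ∧ vertexColors c' S = m}.ncard := by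
  obtain ⟨e, he⟩ := h.exists_equiv hc
  have h1 : {w | SpansBlock G v w ∧ vertexColors c (block G v w) = m}.ncard =
      {w | SpansBlock H v' w ∧ vertexColors c' (block H v' w) = m}.ncard :=
    ncard_setOf_eq_of_equiv e fun w => by
      rw [spansBlock_iff_of_color_eq h hadj (he w).2, vertexColors_block_eq h hadj (he w).2]
  rw [ncard_spansBlock_eq_mul, ncard_spansBlock_eq_mul] at h1
  exact Nat.eq_of_mul_eq_mul_left (by omega) h1

theorem ncard_incidence_eq_mul (m : Multiset C) :
    {p : A × Set A | p.1 ∈ p.2 ∧ p.2 ∈ vertexBCC G ∧ vertexColors c p.2 = m}.ncard =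
      m.card * {S | S ∈ vertexBCC G ∧ vertexColors c S = m}.ncard := by
  refine ncard_eq_mul_of_fiber Prod.snd (fun p hp => hp.2) ?_
  rintro S ⟨hS, rfl⟩
  rw [card_vertexColors, ← Set.ncard_image_of_injective S (Prod.mk_left_injective S)]
  congr 1
  ext ⟨v, S'⟩
  constructor
  · rintro ⟨⟨h1, -⟩, rfl⟩
    exact ⟨v, h1, rfl⟩
  · rintro ⟨w, hw, heq⟩
    obtain ⟨rfl, rfl⟩ := Prod.mk.inj heq
    exact ⟨⟨hw, hS, rfl⟩, rfl⟩

theorem setOf_vertexColors_eq_zero_eq_empty :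
    {S | S ∈ vertexBCC G ∧ vertexColors c S = 0} = ∅ := by
  refine Set.eq_empty_of_forall_notMem ?_
  rintro S ⟨hS, hS0⟩
  have h1 := card_vertexColors (c := c) S
  rw [hS0, Multiset.card_zero, eq_comm, Set.ncard_eq_zero] at h1
  exact (mem_vertexBCC_iff.1 hS).1.ne_empty h1

theorem ncard_vertexBCC_eq (h : CoherentPair c c') (hadj : AdjCompatible c c' G H) (e : A ≃ B)
    (he : ∀ v, c v v = c' (e v) (e v)) (m : Multiset C) :
    {S | S ∈ vertexBCC G ∧ vertexColors c S = m}.ncard =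
      {S | S ∈ vertexBCC H ∧ vertexColors c' S = m}.ncard := by
  by_cases hm : m = 0
  · rw [hm, setOf_vertexColors_eq_zero_eq_empty, setOf_vertexColors_eq_zero_eq_empty]
    simp
  · have h1 := ncard_rel_eq e
      (R := fun v S => v ∈ S ∧ S ∈ vertexBCC G ∧ vertexColors c S = m)
      (R' := fun v S => v ∈ S ∧ S ∈ vertexBCC H ∧ vertexColors c' S = m)
      fun v => ncard_vertexBCC_through_eq h hadj (he v) m
    rw [ncard_incidence_eq_mul, ncard_incidence_eq_mul] at h1
    exact Nat.eq_of_mul_eq_mul_left (Multiset.card_pos.2 hm) h1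

/-- The color of a node of the block cut-vertex tree. -/
noncomputable def bcvColor (c : A → A → C) (G : SimpleGraph A) :
    vertexBCC G ⊕ {v // IsCutVertex G v} → Multiset C ⊕ C :=
  Sum.map (fun S => vertexColors c S.1) fun v => c v.1 v.1

/-- Turns counts of tree nodes into counts of vertex sets, which the block counts above supply. -/
theorem ncard_bcvColor_inl (Q : vertexBCC G ⊕ {v // IsCutVertex G v} → Prop) (Q' : Set A → Prop)
    (hQ : ∀ S, Q (Sum.inl S) ↔ Q' S.1) (m : Multiset C) :
    {x | Q x ∧ bcvColor c G x = Sum.inl m}.ncard =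
      {S | Q' S ∧ S ∈ vertexBCC G ∧ vertexColors c S = m}.ncard := by
  symm
  refine Set.ncard_congr (fun S hS => Sum.inl ⟨S, hS.2.1⟩) ?_ ?_ ?_
  · rintro S ⟨h1, h2, h3⟩
    exact ⟨(hQ _).2 h1, by simp [bcvColor, h3]⟩
  · rintro S S' _ _ heq
    simpa using heq
  · rintro (S | v) ⟨h1, h2⟩
    · exact ⟨S.1, ⟨(hQ S).1 h1, S.2, by simpa [bcvColor] using h2⟩, rfl⟩
    · simp [bcvColor] at h2

theorem ncard_bcvColor_inr (Q : vertexBCC G ⊕ {v // IsCutVertex G v} → Prop) (Q' : A → Prop)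
    (hQ : ∀ v, Q (Sum.inr v) ↔ Q' v.1) (d : C) :
    {x | Q x ∧ bcvColor c G x = Sum.inr d}.ncard =
      {v | Q' v ∧ IsCutVertex G v ∧ c v v = d}.ncard := by
  symm
  refine Set.ncard_congr (fun v hv => Sum.inr ⟨v, hv.2.1⟩) ?_ ?_ ?_
  · rintro v ⟨h1, h2, h3⟩
    exact ⟨(hQ _).2 h1, by simp [bcvColor, h3]⟩
  · rintro v v' _ _ heq
    simpa using heq
  · rintro (S | v) ⟨h1, h2⟩
    · simp [bcvColor] at h2
    · exact ⟨v.1, ⟨(hQ v).1 h1, v.2, by simpa [bcvColor] using h2⟩, rfl⟩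

theorem nonempty_bcvTree_iso (h : CoherentPair c c') (hadj : AdjCompatible c c' G H) (e : A ≃ B)
    (he : ∀ v, c v v = c' (e v) (e v)) : Nonempty (BCVTree G ≃g BCVTree H) := by
  refine nonempty_iso_of_isAcyclic_of_equitable isAcyclic_bcvTree isAcyclic_bcvTree
    (p := bcvColor c G) (q := bcvColor c' H) ?_ ?_
  · rintro (m | d)
    · have h1 := ncard_vertexBCC_eq h hadj e he m
      have h2 := ncard_bcvColor_inl (c := c) (G := G) (fun _ => True) (fun _ => True) (by simp) m
      have h3 := ncard_bcvColor_inl (c := c') (G := H) (fun _ => True) (fun _ => True) (by simp) m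
      simp only [true_and] at h2 h3
      rw [h2, h3, h1]
    · have h1 : {v | IsCutVertex G v ∧ c v v = d}.ncard = {v | IsCutVertex H v ∧ c' v v = d}.ncard :=
        ncard_setOf_eq_of_equiv e fun v => by rw [isCutVertex_iff_of_color_eq h hadj (he v), he]
      have h2 := ncard_bcvColor_inr (c := c) (G := G) (fun _ => True) (fun _ => True) (by simp) d
      have h3 := ncard_bcvColor_inr (c := c') (G := H) (fun _ => True) (fun _ => True) (by simp) d
      simp only [true_and] at h2 h3
      rw [h2, h3, h1]
  · rintro (S | v) (S' | v') hxy (m | d)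
    · rw [ncard_bcvColor_inl _ (fun _ => False) (by simp [not_bcvTree_adj_inl_inl]),
        ncard_bcvColor_inl _ (fun _ => False) (by simp [not_bcvTree_adj_inl_inl])]
      simp
    · rw [ncard_bcvColor_inr _ (· ∈ S.1) fun _ => bcvTree_adj_inl_inr,
        ncard_bcvColor_inr _ (· ∈ S'.1) fun _ => bcvTree_adj_inl_inr]
      -- Neighbors of a block are its cut vertices, and `f` matches those of each color.
      obtain ⟨f, hf⟩ := exists_equiv_of_vertexColors_eq (Sum.inl.inj hxy)
      rw [← Nat.card_coe_set_eq, ← Nat.card_coe_set_eq]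
      refine Nat.card_congr (((Equiv.subtypeSubtypeEquivSubtypeInter (· ∈ S.1) _).symm.trans
        (f.subtypeEquiv fun v => ?_)).trans (Equiv.subtypeSubtypeEquivSubtypeInter (· ∈ S'.1) _))
      rw [isCutVertex_iff_of_color_eq h hadj (hf v), hf]
    · cases hxy
    · cases hxy
    · cases hxy
    · cases hxy
    · rw [ncard_bcvColor_inl _ (v.1 ∈ ·) fun _ => bcvTree_adj_inr_inl,
        ncard_bcvColor_inl _ (v'.1 ∈ ·) fun _ => bcvTree_adj_inr_inl]
      exact ncard_vertexBCC_through_eq h hadj (Sum.inr.inj hxy) m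
    · rw [ncard_bcvColor_inr _ (fun _ => False) (by simp [not_bcvTree_adj_inr_inr]),
        ncard_bcvColor_inr _ (fun _ => False) (by simp [not_bcvTree_adj_inr_inr])]
      simp

end BlockColors

/-! ### From final colors to the theorem. -/

section Final

variable {C A B : Type*} [Fintype A] [Fintype B] {P : ColorScheme C} {G : SimpleGraph A}
  {H : SimpleGraph B} {T : ℕ}

/-- Vertices with the same final color are related by a coherent pair of colorings that the final
colors refine. -/
theorem exists_coherentPair_of_nodeColor_eq (hT : Fintype.card A ^ 2 ≤ T) {u : A} {v : B}
    (h : nodeColor P G T u = nodeColor P H T v) :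
    ∃ (c : A → A → C) (c' : B → B → C), CoherentPair c c' ∧ CoherentPair c' c' ∧
      AdjCompatible c c' G H ∧ AdjCompatible c' c' H H ∧
      ∀ x y, nodeColor P G T x = nodeColor P H T y → c x x = c' y y := by
  obtain ⟨t, ht, h1, -, h3⟩ := exists_fwlStable P hT h
  exact ⟨fwl P G t, fwl P H t, h1.coherentPair, h3.coherentPair, adjCompatible_fwl,
    adjCompatible_fwl, fun x y hxy => fwl_eq_of_le P ht hxy⟩

theorem isCutVertex_of_nodeColor_eq (hT : Fintype.card A ^ 2 ≤ T) {u : A} {v : B}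
    (h : nodeColor P G T u = nodeColor P H T v) (hu : IsCutVertex G u) : IsCutVertex H v := by
  obtain ⟨c, c', hc, -, hadj, -, hcol⟩ := exists_coherentPair_of_nodeColor_eq hT h
  exact hu.of_color_eq hc hadj (hcol _ _ h)

theorem isCutEdge_of_nodeColor_eq (hT : Fintype.card A ^ 2 ≤ T) {u v : A} {w x : B}
    (huw : nodeColor P G T u = nodeColor P H T w) (hvx : nodeColor P G T v = nodeColor P H T x)
    (huv : IsCutEdge G s(u, v)) (hwx : H.Adj w x) : IsCutEdge H s(w, x) := by
  obtain ⟨c, c', hc, hc', hadj, hadj', hcol⟩ := exists_coherentPair_of_nodeColor_eq hT huw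
  exact huv.of_vertexColor_eq hc hc' hadj hadj' (hcol _ _ huw) (hcol _ _ hvx) hwx

theorem isCutEdge_of_edgeFeature_eq (hT : Fintype.card A ^ 2 ≤ T) {u v : A} {w x : B}
    (h : edgeFeature P G T u v = edgeFeature P H T w x) (huv : IsCutEdge G s(u, v))
    (hwx : H.Adj w x) : IsCutEdge H s(w, x) := by
  simp only [edgeFeature, Multiset.insert_eq_cons] at h
  rcases Multiset.cons_eq_cons.1 h with ⟨h1, h2⟩ | ⟨-, D, h2, h1⟩
  · exact isCutEdge_of_nodeColor_eq hT h1 (Multiset.singleton_inj.1 h2) huv hwx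
  -- Here the endpoint colors match crosswise.
  · rw [Multiset.singleton_eq_cons_iff] at h1 h2
    exact Sym2.eq_swap ▸ isCutEdge_of_nodeColor_eq hT h1.1.symm h2.1 huv hwx.symm

theorem exists_equiv_of_graphRep_eq (h : graphRep P G T = graphRep P H T) :
    ∃ e : A ≃ B, ∀ v, nodeColor P G T v = nodeColor P H T (e v) :=
  exists_equiv_of_univ_map_eq _ _ h

theorem connected_of_graphRep_eq (hT : Fintype.card A ^ 2 ≤ T)
    (h : graphRep P G T = graphRep P H T) (hG : G.Connected) : H.Connected := by
  obtain ⟨e, he⟩ := exists_equiv_of_graphRep_eq h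
  obtain ⟨u⟩ := hG.nonempty
  obtain ⟨c, c', hc, -, hadj, -, hcol⟩ := exists_coherentPair_of_nodeColor_eq hT (he u)
  exact connected_of_color_eq hc hadj (hcol _ _ (he u)) hG

theorem vertexBiconnected_of_graphRep_eq (hTA : Fintype.card A ^ 2 ≤ T)
    (hTB : Fintype.card B ^ 2 ≤ T) (h : graphRep P G T = graphRep P H T)
    (hG : VertexBiconnected G) : VertexBiconnected H := by
  obtain ⟨e, he⟩ := exists_equiv_of_graphRep_eq h
  refine ⟨connected_of_graphRep_eq hTA h hG.1, fun v hv => hG.2 (e.symm v) ?_⟩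
  -- The roles of the graphs are exchanged: a cut vertex of `H` is carried back to `G`.
  refine isCutVertex_of_nodeColor_eq (P := P) hTB ?_ hv
  rw [he, e.apply_symm_apply]

theorem edgeBiconnected_of_graphRep_eq (hTA : Fintype.card A ^ 2 ≤ T)
    (hTB : Fintype.card B ^ 2 ≤ T) (h : graphRep P G T = graphRep P H T)
    (hG : EdgeBiconnected G) : EdgeBiconnected H := by
  obtain ⟨e, he⟩ := exists_equiv_of_graphRep_eq h
  refine ⟨connected_of_graphRep_eq hTA h hG.1, fun edge => ?_⟩
  induction edge using Sym2.ind with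
  | _ w x =>
    intro hwx
    have hw : nodeColor P H T w = nodeColor P G T (e.symm w) := by rw [he, e.apply_symm_apply]
    obtain ⟨c, c', hc, -, hadj, -, hcol⟩ := exists_coherentPair_of_nodeColor_eq hTB hw
    obtain ⟨y, hy, -⟩ := hc.exists_triple (hcol _ _ hw) x
    exact hG.2 _ (hwx.of_color_eq hc hadj hy)

theorem nonempty_bcTree_iso_of_graphRep_eq (hT : Fintype.card A ^ 2 ≤ T)
    (h : graphRep P G T = graphRep P H T) :
    Nonempty (BCVTree G ≃g BCVTree H) ∧ Nonempty (BCETree G ≃g BCETree H) := by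
  obtain ⟨e, he⟩ := exists_equiv_of_graphRep_eq h
  obtain ⟨c, c', hc, hadj, hcol⟩ : ∃ (c : A → A → C) (c' : B → B → C), CoherentPair c c' ∧
      AdjCompatible c c' G H ∧ ∀ v, c v v = c' (e v) (e v) := by
    -- Without vertices there is no color equality to start from, and all conditions are vacuous.
    cases isEmpty_or_nonempty A
    · have hB : IsEmpty B := e.symm.isEmpty
      exact ⟨isEmptyElim, isEmptyElim, ⟨fun {u} => isEmptyElim u, fun {u} => isEmptyElim u,
        fun {u} => isEmptyElim u⟩, fun {u} => isEmptyElim u, fun u => isEmptyElim u⟩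
    · obtain ⟨c, c', hc, -, hadj, -, hcol⟩ :=
        exists_coherentPair_of_nodeColor_eq hT (he (Classical.arbitrary A))
      exact ⟨c, c', hc, hadj, fun v => hcol _ _ (he v)⟩
  exact ⟨nonempty_bcvTree_iso hc hadj e hcol, nonempty_bceTree_iso hc hadj e hcol⟩

end Final

end Biconn

theorem corollary4p7 {C VG VH : Type*} [Fintype VG] [Fintype VH]
    (P : Biconn.ColorScheme C) (G : SimpleGraph VG) (H : SimpleGraph VH)
    (T : ℕ) (hTG : Fintype.card VG ^ 2 ≤ T) (hTH : Fintype.card VH ^ 2 ≤ T) :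
    -- whether a graph is biconnected
    (Biconn.VertexBiconnected G → ¬ Biconn.VertexBiconnected H →
      Biconn.graphRep P G T ≠ Biconn.graphRep P H T) ∧
    (Biconn.EdgeBiconnected G → ¬ Biconn.EdgeBiconnected H →
      Biconn.graphRep P G T ≠ Biconn.graphRep P H T) ∧
    -- cut vertices
    (∀ (u : VG) (v : VH), Biconn.IsCutVertex G u → ¬ Biconn.IsCutVertex H v →
      Biconn.nodeColor P G T u ≠ Biconn.nodeColor P H T v) ∧
    -- cut edges
    (∀ (u v : VG) (w x : VH), G.Adj u v → H.Adj w x →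
      Biconn.IsCutEdge G s(u, v) → ¬ Biconn.IsCutEdge H s(w, x) →
      Biconn.edgeFeature P G T u v ≠ Biconn.edgeFeature P H T w x) ∧
    -- block cut trees
    (IsEmpty (Biconn.BCVTree G ≃g Biconn.BCVTree H) →
      Biconn.graphRep P G T ≠ Biconn.graphRep P H T) ∧
    (IsEmpty (Biconn.BCETree G ≃g Biconn.BCETree H) →
      Biconn.graphRep P G T ≠ Biconn.graphRep P H T) := by
  refine ⟨fun hG hH h => hH (Biconn.vertexBiconnected_of_graphRep_eq hTG hTH h hG),
    fun hG hH h => hH (Biconn.edgeBiconnected_of_graphRep_eq hTG hTH h hG),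
    fun u v hu hv h => hv (Biconn.isCutVertex_of_nodeColor_eq hTG h hu),
    fun u v w x _ hwx huv hncut h => hncut (Biconn.isCutEdge_of_edgeFeature_eq hTG h huv hwx),
    fun hempty h => ?_, fun hempty h => ?_⟩
  · obtain ⟨f⟩ := (Biconn.nonempty_bcTree_iso_of_graphRep_eq hTG h).1
    exact hempty.false f
  · obtain ⟨f⟩ := (Biconn.nonempty_bcTree_iso_of_graphRep_eq hTG h).2
    exact hempty.false f
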